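/- Let $(\Omega,\Sigma,\mu)$ be a space with a finite measure and assume that every atom of $\mu$ contains a point of positive outer measure (this holds trivially if $\mu$ is atomless). Here an atom is a set $A\in\Sigma$ with $\mu(A)>0$ such that every $B\in\Sigma$ with $B\subset A$ satisfies $\mu(B)=0$ or $\mu(A\setminus B)=0$. Let $X$ be a weakly compactly generated (real) Banach space, i.e. $X$ is the closed linear span of a weakly compact set. Let $f:\Omega\to X$ be an arbitrary function, possibly non-measurable, belonging to $\overline{L_1}(\Omega,\Sigma,\mu,X)$, i.e. such that the upper Lebesgue integral $$\overline{\int}\|f\|\,d\mu=\inf\Big\{\int g\,d\mu:\ g \text{ integrable},\ g(t)\ge\|f(t)\|\ \text{for all } t\in\Omega\Big\}$$ is finite (the infimum of the empty set being $+\infty$). For a partition $\Gamma=\{\Delta_i\}$ of $\Omega$ into countably many measurable sets (cells) and sampling points $T=\{t_i\}$, $t_i\in\Delta_i$, put $S(f,\Gamma,T)=\sum_i f(t_i)\mu(\Delta_i)$; this is called an absolute integral sum if the series converges absolutely. Write $\Gamma\succ\Pi$ if $\Gamma$ is finer than $\Pi$, i.e. every cell of $\Pi$ is a union of cells of $\Gamma$.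 Let $I(f)$ be the set of all $x\in X$ such that for every $\varepsilon>0$ and every partition $\Pi$ there are a partition $\Gamma\succ\Pi$ and sampling points $T$ for $\Gamma$ for which $S(f,\Gamma,T)$ is an absolute integral sum and $\|S(f,\Gamma,T)-x\|<\varepsilon$. Then $I(f)$ is non-empty. -/

import Mathlib

open MeasureTheory
open scoped ENNReal NNReal

noncomputable section

namespace RLIntegral

/-- The upper Lebesgue integral of an arbitrary nonnegative function: the infimum of `∫ g dμ` over
all integrable `g` with `g(t) ≥ f(t)` for every `t`, equal to `∞` if there is no such `g`. -/
def upperIntegral {Ω : Type*} [MeasurableSpace Ω] (μ : Measure Ω) (f : Ω → ℝ≥0) : ℝ≥0∞ :=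
  ⨅ (g : Ω → ℝ) (_ : Integrable g μ) (_ : ∀ t, (f t : ℝ) ≤ g t), ENNReal.ofReal (∫ t, g t ∂μ)

/-- The upper `L₁` space: all functions whose norm has finite upper Lebesgue integral. -/
def upperL1 {Ω : Type*} [MeasurableSpace Ω] (μ : Measure Ω) (X : Type*) [NormedAddCommGroup X] :
    Set (Ω → X) :=
  {f | upperIntegral μ (fun t => ‖f t‖₊) < ∞}

/-- A partition of `Ω` into countably many (finitely or infinitely many) measurable sets.
Empty cells, which contribute nothing to an integral sum, are left out. -/
structure CountablePartition (Ω : Type*) [MeasurableSpace Ω] where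
  cells : Set (Set Ω)
  countable : cells.Countable
  measurableSet : ∀ D ∈ cells, MeasurableSet D
  isPartition : Setoid.IsPartition cells

/-- `Γ` is finer than (follows) `P`: every cell of `Γ` lies in a cell of `P`. -/
def CountablePartition.Finer {Ω : Type*} [MeasurableSpace Ω] (Γ P : CountablePartition Ω) : Prop :=
  ∀ D ∈ Γ.cells, ∃ E ∈ P.cells, D ⊆ E

/-- `Γ` is finer than `P` exactly when every cell of `P` is a union of cells of `Γ`. -/
theorem CountablePartition.finer_iff {Ω : Type*} [MeasurableSpace Ω]
    (Γ P : CountablePartition Ω) :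
    Γ.Finer P ↔ ∀ E ∈ P.cells, ∃ I ⊆ Γ.cells, E = ⋃₀ I := by
  constructor
  · intro h E hE
    refine ⟨{D | D ∈ Γ.cells ∧ D ⊆ E}, fun D hD => hD.1, ?_⟩
    ext t
    constructor
    · intro ht
      obtain ⟨D, ⟨hD, htD⟩, -⟩ := Γ.isPartition.2 t
      obtain ⟨E', hE', hDE'⟩ := h D hD
      have hEE : E' = E := (P.isPartition.2 t).unique ⟨hE', hDE' htD⟩ ⟨hE, ht⟩
      exact ⟨D, ⟨hD, hEE ▸ hDE'⟩, htD⟩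
    · rintro ⟨D, hD, htD⟩
      exact hD.2 htD
  · intro h D hD
    obtain ⟨t, ht⟩ := Setoid.nonempty_of_mem_partition Γ.isPartition hD
    obtain ⟨E, ⟨hE, htE⟩, -⟩ := P.isPartition.2 t
    obtain ⟨I, hI, rfl⟩ := h E hE
    obtain ⟨D', hD', htD'⟩ := htE
    have hDD : D' = D := (Γ.isPartition.2 t).unique ⟨hI hD', htD'⟩ ⟨hD, ht⟩
    exact ⟨_, hE, hDD ▸ Set.subset_sUnion_of_mem hD'⟩

/-- `T` chooses a sampling point in every cell of `Γ`. -/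
def IsSampling {Ω : Type*} [MeasurableSpace Ω] (Γ : CountablePartition Ω) (T : Γ.cells → Ω) :
    Prop :=
  ∀ D : Γ.cells, T D ∈ (D : Set Ω)

/-- The term `f(t_D) μ(D)` of the integral sum `S(f, Γ, T)`. -/
def sumTerm {Ω : Type*} [MeasurableSpace Ω] (μ : Measure Ω)
    {X : Type*} [NormedAddCommGroup X] [NormedSpace ℝ X] (f : Ω → X)
    (Γ : CountablePartition Ω) (T : Γ.cells → Ω) (D : Γ.cells) : X :=
  μ.real (D : Set Ω) • f (T D)

/-- `S(f, Γ, T)` is an absolute integral sum: the series is absolutely convergent. -/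
def IsAbsoluteSum {Ω : Type*} [MeasurableSpace Ω] (μ : Measure Ω)
    {X : Type*} [NormedAddCommGroup X] [NormedSpace ℝ X] (f : Ω → X)
    (Γ : CountablePartition Ω) (T : Γ.cells → Ω) : Prop :=
  Summable fun D => ‖sumTerm μ f Γ T D‖

/-- The value of the integral sum `S(f, Γ, T)`. -/
def integralSum {Ω : Type*} [MeasurableSpace Ω] (μ : Measure Ω)
    {X : Type*} [NormedAddCommGroup X] [NormedSpace ℝ X] (f : Ω → X)
    (Γ : CountablePartition Ω) (T : Γ.cells → Ω) : X :=
  ∑' D, sumTerm μ f Γ T D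

/-- The limit set `I(f)`: all limit points of the net of absolute integral sums of `f`. -/
def limitSet {Ω : Type*} [MeasurableSpace Ω] (μ : Measure Ω)
    {X : Type*} [NormedAddCommGroup X] [NormedSpace ℝ X] (f : Ω → X) : Set X :=
  {x | ∀ ε > (0 : ℝ), ∀ P : CountablePartition Ω, ∃ Γ : CountablePartition Ω, Γ.Finer P ∧
    ∃ T : Γ.cells → Ω, IsSampling Γ T ∧ IsAbsoluteSum μ f Γ T ∧ ‖integralSum μ f Γ T - x‖ < ε}

/-- `X` is weakly compactly generated: it is the closed linear span of a weakly compact set. -/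
def IsWCG (X : Type*) [NormedAddCommGroup X] [NormedSpace ℝ X] : Prop :=
  ∃ K : Set X, IsCompact (toWeakSpace ℝ X '' K) ∧ Dense (Submodule.span ℝ K : Set X)

/-- `A` is an atom of `μ`: a measurable set of nonzero measure each of whose measurable subsets is
null or has null complement in `A`. -/
def IsMeasureAtom {Ω : Type*} [MeasurableSpace Ω] (μ : Measure Ω) (A : Set Ω) : Prop :=
  MeasurableSet A ∧ μ A ≠ 0 ∧ ∀ B ⊆ A, MeasurableSet B → μ B = 0 ∨ μ (A \ B) = 0

/-- Every atom of `μ` contains a point of positive outer measure (`μ {t}` is the outer measure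
of `{t}`, which need not be measurable). An atomless measure satisfies this trivially. -/
def AtomsChargePoints {Ω : Type*} [MeasurableSpace Ω] (μ : Measure Ω) : Prop :=
  ∀ A : Set Ω, IsMeasureAtom μ A → ∃ t ∈ A, μ {t} ≠ 0

end RLIntegral

end

/-! An integral sum depends only on the weight w(t) that each sampling point receives, and it equals
∑ w(t) f(t). Fix a set E of full outer measure whose points are separated by measurable sets, and a
suitable partition. Then every weight on E that gives each cell its measure, and for which the
series converges absolutely, comes from an integral sum (`exists_sampling_of_mem_sampleWeights`): an
atomless cell is cut into pieces of prescribed measure by Sierpiński's theorem, and any other cell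
has at most one admissible point. The gain is convexity: these sums form a convex set
(`convex_sampleSums`).

Weak compact generation makes f(t), up to δ, an integer multiple M(t) of a point of the convex hull
of one weakly compact set L. Although f is not measurable, M can be taken measurable after E is
shrunk to a smaller full set (`IsFull.exists_measurable_index`). Admissible weights integrate
functions of the cell index exactly, which controls the tail {M > m}; hence the sums lie within ε of
a fixed multiple of conv L (`exists_norm_tsum_sub_le`).

The sets of admissible weights, for shrinking E and refining partitions, generate a proper filter.
Along an ultrafilter containing it the sums converge weakly, by Krein's theorem with small errors
(`exists_forall_tendsto_of_approx`). By Mazur's theorem the weak limit lies in the norm closure of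
each convex set of sums, so it belongs to I(f). -/

noncomputable section

namespace RLIntegral

open Filter Topology Set
open scoped Pointwise

/-! ### Weak limits and Krein's theorem -/

section WeakCompactness

variable {X : Type*} [NormedAddCommGroup X] [NormedSpace ℝ X]

/-- A weakly compact set is bounded in norm. -/
theorem exists_norm_le_of_isCompact {L : Set X} (hL : IsCompact (toWeakSpace ℝ X '' L)) :
    ∃ C, ∀ x ∈ L, ‖x‖ ≤ C := by
  have h : ∀ φ : StrongDual ℝ X, ∃ C, ∀ x : L,
      ‖NormedSpace.inclusionInDoubleDual ℝ X (x : X) φ‖ ≤ C := by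
    intro φ
    have hφ : Continuous fun z : WeakSpace ℝ X => φ ((toWeakSpace ℝ X).symm z) :=
      WeakBilin.eval_continuous (topDualPairing ℝ X).flip φ
    obtain ⟨C, hC⟩ := (hL.image hφ).isBounded.exists_norm_le
    refine ⟨C, fun x => hC _ ?_⟩
    exact ⟨_, ⟨x, x.2, rfl⟩, by simp⟩
  obtain ⟨C, hC⟩ := banach_steinhaus h
  refine ⟨C, fun x hx => ?_⟩
  have := hC ⟨x, hx⟩
  rwa [← (NormedSpace.inclusionInDoubleDualLi ℝ (E := X)).norm_map x]

/-- A closed convex set is weakly closed. -/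
theorem isClosed_toWeakSpace_image {s : Set X} (hs : Convex ℝ s) (hc : IsClosed s) :
    IsClosed (toWeakSpace ℝ X '' s) := by
  have := hs.toWeakSpace_closure ℝ
  rw [hc.closure_eq] at this
  rw [this]
  exact isClosed_closure

/-- A closed convex set contains every weak limit of its elements. -/
theorem mem_of_forall_tendsto {s : Set X} (hs : Convex ℝ s) (hc : IsClosed s)
    {ι : Type*} {F : Filter ι} [F.NeBot] {a : ι → X} (ha : ∀ᶠ i in F, a i ∈ s) {x : X}
    (hx : ∀ φ : StrongDual ℝ X, Tendsto (fun i => φ (a i)) F (𝓝 (φ x))) : x ∈ s := by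
  by_contra hxs
  obtain ⟨φ, u, hu, hux⟩ := geometric_hahn_banach_closed_point hs hc hxs
  have : φ x ≤ u := le_of_tendsto (hx φ) (ha.mono fun i hi => (hu _ hi).le)
  linarith

/-- If balls have measurable preimages, a map into a metric space with separable range is
strongly measurable. -/
theorem stronglyMeasurable_of_closedBall {X : Type*} [NormedAddCommGroup X] {T : Type*} [MeasurableSpace T] {v : T → X}
    (hsep : TopologicalSpace.IsSeparable (range v))
    (hv : ∀ x r, MeasurableSet (v ⁻¹' Metric.closedBall x r)) : StronglyMeasurable v := by
  borelize X
  refine stronglyMeasurable_iff_measurable_separable.2 ⟨?_, hsep⟩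
  refine measurable_of_isOpen fun O hO => ?_
  obtain ⟨c, hc, hcs⟩ := hsep
  have : v ⁻¹' O = ⋃ p ∈ {p : X × ℚ | p ∈ c ×ˢ univ ∧ Metric.closedBall p.1 p.2 ⊆ O},
      v ⁻¹' Metric.closedBall p.1 p.2 := by
    ext t
    simp only [mem_preimage, mem_iUnion]
    constructor
    · intro ht
      obtain ⟨ε, hε, hεO⟩ := Metric.isOpen_iff.1 hO _ ht
      obtain ⟨x, hxc, hx⟩ := Metric.mem_closure_iff.1 (hcs ⟨t, rfl⟩) (ε / 3) (by positivity)
      obtain ⟨q, hq, hq'⟩ := exists_rat_btwn (show ε / 3 < ε / 2 by linarith)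
      refine ⟨(x, q), ⟨⟨hxc, mem_univ _⟩, fun z hz => hεO ?_⟩, ?_⟩
      · have := dist_triangle z x (v t)
        rw [dist_comm x (v t)] at this
        simp only [Metric.mem_closedBall, Metric.mem_ball] at *
        linarith
      · simp only [Metric.mem_closedBall]
        linarith
    · rintro ⟨p, hp, hpt⟩
      exact hp.2 hpt
  rw [this]
  refine MeasurableSet.biUnion ?_ fun p _ => hv _ _
  exact (hc.prod countable_univ).mono fun p hp => hp.1

/-- Krein's theorem for sequences: a sequence in the convex hull of a weakly compact set
converges weakly along every ultrafilter. -/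
theorem exists_forall_tendsto_of_mem_convexHull [CompleteSpace X] {L : Set X}
    (hL : IsCompact (toWeakSpace ℝ X '' L)) (U : Ultrafilter ℕ) (a : ℕ → X)
    (ha : ∀ n, a n ∈ convexHull ℝ L) :
    ∃ x, ∀ φ : StrongDual ℝ X, Tendsto (fun n => φ (a n)) U (𝓝 (φ x)) := by
  have h1 : ∀ n, ∃ (k : ℕ) (w : Fin k → ℝ) (z : Fin k → X), (∀ i, 0 ≤ w i) ∧ ∑ i, w i = 1 ∧
      (∀ i, z i ∈ L) ∧ ∑ i, w i • z i = a n := by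
    intro n
    obtain ⟨ι, _, w, z, h0, h1, hz, h⟩ := mem_convexHull_iff_exists_fintype.1 (ha n)
    let e := (Fintype.equivFin ι).symm
    refine ⟨_, w ∘ e, z ∘ e, fun i => h0 _, ?_, fun i => hz _, ?_⟩
    · rw [← h1]; exact e.sum_comp w
    · rw [← h]; exact e.sum_comp fun i => w i • z i
  choose k w z hw0 hw1 hz hsum using h1
  -- Only countably many points of `L` occur. Intersecting `L` with their closed span keeps weak
  -- compactness and makes the range of `v` below separable.
  let Y : Submodule ℝ X := (Submodule.span ℝ (⋃ n, range (z n))).topologicalClosure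
  have hYsep : TopologicalSpace.IsSeparable (Y : Set X) := by
    have : TopologicalSpace.IsSeparable (⋃ n, range (z n)) :=
      (countable_iUnion fun n => countable_range _).isSeparable
    exact (this.span (R := ℝ)).closure
  let T : Set (WeakSpace ℝ X) := toWeakSpace ℝ X '' (L ∩ Y)
  have hTc : IsCompact T := by
    have : T = toWeakSpace ℝ X '' L ∩ toWeakSpace ℝ X '' Y :=
      image_inter (toWeakSpace ℝ X).injective
    rw [this]
    exact hL.inter_right
      (isClosed_toWeakSpace_image Y.convex (Submodule.isClosed_topologicalClosure _))
  have : CompactSpace T := isCompact_iff_compactSpace.1 hTc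
  borelize ↥T
  let v : T → X := fun t => (toWeakSpace ℝ X).symm t
  have hvY : ∀ t, v t ∈ L ∩ (Y : Set X) := by
    rintro ⟨-, x, hx, rfl⟩
    simpa [v] using hx
  have hφv : ∀ φ : StrongDual ℝ X, Continuous fun t => φ (v t) := fun φ =>
    (WeakBilin.eval_continuous (topDualPairing ℝ X).flip φ).comp continuous_subtype_val
  -- `v` is not norm continuous, but norm balls are closed and convex, hence weakly closed, so their
  -- preimages are Borel.
  have hvm : StronglyMeasurable v := by
    refine stronglyMeasurable_of_closedBall (hYsep.mono ?_) fun x r => ?_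
    · rintro - ⟨t, rfl⟩
      exact (hvY t).2
    · have := (isClosed_toWeakSpace_image (convex_closedBall x r) Metric.isClosed_closedBall).preimage
        (continuous_subtype_val (p := (· ∈ T)))
      convert this.measurableSet using 1
      ext t
      simp only [mem_preimage, mem_image, v]
      constructor
      · intro h
        exact ⟨_, h, by simp⟩
      · rintro ⟨y, hy, h⟩
        rw [← h]
        simpa using hy
  obtain ⟨C, hC⟩ := exists_norm_le_of_isCompact hL
  have hzT : ∀ n i, toWeakSpace ℝ X (z n i) ∈ T := fun n i =>
    ⟨_, ⟨hz n i, Submodule.le_topologicalClosure _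
      (Submodule.subset_span (mem_iUnion.2 ⟨n, i, rfl⟩))⟩, rfl⟩
  let m : ℕ → Measure T := fun n =>
    ∑ i, ENNReal.ofReal (w n i) • Measure.dirac (⟨_, hzT n i⟩ : T)
  have hm : ∀ n, IsProbabilityMeasure (m n) := by
    intro n
    constructor
    simp only [m, Measure.coe_finsetSum, Finset.sum_apply, Measure.smul_apply, measure_univ,
      smul_eq_mul, mul_one]
    rw [← ENNReal.ofReal_sum_of_nonneg fun i _ => hw0 n i, hw1, ENNReal.ofReal_one]
  let M : ℕ → ProbabilityMeasure T := fun n => ⟨m n, hm n⟩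
  -- `m n` has barycentre `a n`. Probability measures on the compact set `T` form a compact space,
  -- and the barycentre of the limit measure is the required weak limit.
  obtain ⟨P, -, hP⟩ := isCompact_univ.ultrafilter_le_nhds (U.map M) (by simp)
  have hP' : Tendsto M U (𝓝 P) := hP
  refine ⟨∫ t, v t ∂(P : Measure T), fun φ => ?_⟩
  have hint : Integrable v (P : Measure T) :=
    Integrable.of_bound hvm.aestronglyMeasurable C (Eventually.of_forall fun t => hC _ (hvY t).1)
  have h2 := ProbabilityMeasure.tendsto_iff_forall_integral_tendsto.1 hP'
    (BoundedContinuousFunction.mkOfCompact ⟨_, hφv φ⟩)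
  rw [← φ.integral_comp_comm hint]
  refine h2.congr fun n => ?_
  simp only [BoundedContinuousFunction.mkOfCompact_apply, ContinuousMap.coe_mk, M, m,
    ProbabilityMeasure.coe_mk]
  rw [integral_finsetSum_measure]
  · rw [← hsum, map_sum]
    refine Finset.sum_congr rfl fun i _ => ?_
    rw [integral_smul_measure, integral_dirac]
    simp [v, hw0]
  · intro i _
    refine Integrable.smul_measure ?_ ENNReal.ofReal_ne_top
    exact Integrable.of_bound (hφv φ).aestronglyMeasurable (‖φ‖ * C)
      (Eventually.of_forall fun t => φ.le_opNorm_of_le (hC _ (hvY t).1))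

/-- A finite-dimensional subspace of a dual space is normed, up to a factor `2`, by finitely many
vectors of the unit ball. -/
theorem exists_finset_norm_le (Z : Submodule ℝ (StrongDual ℝ X)) [FiniteDimensional ℝ Z] :
    ∃ A : Finset X, ∀ z ∈ Z, ∃ x ∈ A, ‖x‖ ≤ 1 ∧ ‖z‖ ≤ 2 * |z x| := by
  have : ProperSpace Z := FiniteDimensional.proper ℝ Z
  -- Each functional of norm 1 exceeds 1/2 in modulus somewhere on the unit ball, and the sphere of
  -- `Z` is compact; a finite subcover yields `A`.
  have hcov : Metric.sphere (0 : Z) 1 ⊆ ⋃ x : Metric.closedBall (0 : X) 1,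
      {z : Z | 1 / 2 < |(z : StrongDual ℝ X) x|} := by
    intro z hz
    by_contra hcon
    simp only [mem_iUnion, mem_ofPred_eq, not_exists, not_lt] at hcon
    have h1 : ‖(z : StrongDual ℝ X)‖ ≤ 1 / 2 := by
      refine ContinuousLinearMap.opNorm_le_of_unit_norm (by norm_num) fun x hx => ?_
      exact hcon ⟨x, by simp [hx]⟩
    have h2 : ‖(z : StrongDual ℝ X)‖ = 1 := mem_sphere_zero_iff_norm.1 hz
    linarith
  obtain ⟨t, ht⟩ := (isCompact_sphere (0 : Z) 1).elim_finite_subcover _ (fun x =>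
    isOpen_lt continuous_const (by fun_prop)) hcov
  classical
  -- The vector 0 serves `z = 0`, which the sphere does not cover.
  refine ⟨insert 0 (t.image Subtype.val), fun z hz => ?_⟩
  rcases eq_or_ne z 0 with rfl | hz0
  · exact ⟨0, by simp, by simp, by simp⟩
  · have hzn : 0 < ‖z‖ := norm_pos_iff.2 hz0
    have : (⟨‖z‖⁻¹ • z, Z.smul_mem _ hz⟩ : Z) ∈ Metric.sphere (0 : Z) 1 :=
      mem_sphere_zero_iff_norm.2 (show ‖‖z‖⁻¹ • z‖ = 1 by
        rw [norm_smul, norm_inv, norm_norm, inv_mul_cancel₀ hzn.ne'])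
    obtain ⟨x, hxt, hx⟩ := by simpa only [mem_iUnion] using ht this
    refine ⟨x, ?_, mem_closedBall_zero_iff.1 x.2, ?_⟩
    · exact Finset.mem_insert_of_mem (Finset.mem_image_of_mem _ hxt)
    · have hx' : 1 / 2 < |‖z‖⁻¹ * z x| := hx
      rw [abs_mul, abs_inv, abs_norm, inv_mul_eq_div, lt_div_iff₀ hzn] at hx'
      linarith

theorem exists_finset_norm_sub_le (Z : Submodule ℝ (StrongDual ℝ X)) [FiniteDimensional ℝ Z] :
    ∃ A : Finset X, ∀ z ∈ Z, ∀ w ∈ Z, ∃ x ∈ A, ‖x‖ ≤ 1 ∧ ‖z - w‖ ≤ 2 * |z x - w x| := by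
  obtain ⟨A, hA⟩ := exists_finset_norm_le Z
  exact ⟨A, fun z hz w hw => hA _ (Z.sub_mem hz hw)⟩

/-- Krein's theorem: every ultrafilter that contains the convex hull of a weakly compact set
converges weakly. -/
theorem exists_forall_tendsto_of_convexHull_mem [CompleteSpace X] {L : Set X}
    (hL : IsCompact (toWeakSpace ℝ X '' L)) {ι : Type*} (F : Ultrafilter ι) (s : ι → X)
    (hs : ∀ᶠ i in (F : Filter ι), s i ∈ convexHull ℝ L) :
    ∃ x, ∀ φ : StrongDual ℝ X, Tendsto (fun i => φ (s i)) F (𝓝 (φ x)) := by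
  obtain ⟨C, hC⟩ := exists_norm_le_of_isCompact hL
  have hC' : ∀ x ∈ convexHull ℝ L, ‖x‖ ≤ C := by
    intro x hx
    have : convexHull ℝ L ⊆ Metric.closedBall 0 C :=
      convexHull_min (fun y hy => by simpa using hC y hy) (convex_closedBall _ _)
    simpa using this hx
  have hlim : ∀ φ : StrongDual ℝ X, ∃ c, |c| ≤ C * ‖φ‖ ∧
      Tendsto (fun i => φ (s i)) F (𝓝 c) := by
    intro φ
    obtain ⟨c, hc, h⟩ := (isCompact_Icc (a := -(C * ‖φ‖)) (b := C * ‖φ‖)).ultrafilter_le_nhds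
      (F.map fun i => φ (s i)) (by
        rw [le_principal_iff]
        change ∀ᶠ i in (F : Filter ι), _
        filter_upwards [hs] with i hi
        rw [mem_Icc, ← abs_le, mul_comm]
        exact φ.le_opNorm_of_le (hC' _ hi))
    exact ⟨c, abs_le.2 hc, h⟩
  choose c hc hcl using hlim
  let Φ : StrongDual ℝ (StrongDual ℝ X) := LinearMap.mkContinuous
    { toFun := c
      map_add' := fun φ ψ => tendsto_nhds_unique (hcl (φ + ψ)) ((hcl φ).add (hcl ψ))
      map_smul' := fun r φ => tendsto_nhds_unique (hcl (r • φ)) ((hcl φ).const_mul r) } C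
    fun φ => hc φ
  have hΦ : ∀ φ, Φ φ = c φ := fun φ => rfl
  let J := NormedSpace.inclusionInDoubleDual ℝ X
  -- The limit exists as an element `Φ` of the bidual; it has to be shown to come from `X`. `N S`
  -- norms the finite-dimensional span of `Φ` and `J '' S` up to the factor 2.
  have hN : ∀ S : Finset X, ∃ A : Finset (StrongDual ℝ X), ∀ x ∈ Submodule.span ℝ (S : Set X),
      ∃ φ ∈ A, ‖φ‖ ≤ 1 ∧ ‖Φ - J x‖ ≤ 2 * |Φ φ - φ x| := by
    intro S
    let Z : Submodule ℝ (StrongDual ℝ (StrongDual ℝ X)) :=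
      Submodule.span ℝ {Φ} ⊔ (Submodule.span ℝ (S : Set X)).map J.toLinearMap
    have : FiniteDimensional ℝ (Submodule.span ℝ (S : Set X)) :=
      FiniteDimensional.span_finset ℝ S
    obtain ⟨A, hA⟩ := exists_finset_norm_sub_le Z
    refine ⟨A, fun x hx => ?_⟩
    have hΦZ : Φ ∈ Z := Submodule.mem_sup_left (Submodule.mem_span_singleton_self _)
    have hJZ : J x ∈ Z := Submodule.mem_sup_right (Submodule.mem_map_of_mem hx)
    obtain ⟨φ, hφ, h1, h2⟩ := hA Φ hΦZ (J x) hJZ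
    exact ⟨φ, hφ, h1, h2⟩
  choose N hN using hN
  have hpick : ∀ (A : Finset (StrongDual ℝ X)) (n : ℕ), ∃ a ∈ convexHull ℝ L,
      ∀ φ ∈ A, |φ a - Φ φ| < 1 / (n + 1 : ℝ) := by
    intro A n
    have : ∀ᶠ i in (F : Filter ι), ∀ φ ∈ A, |φ (s i) - Φ φ| < 1 / (n + 1 : ℝ) := by
      rw [Filter.eventually_all_finset]
      intro φ _
      have := Metric.tendsto_nhds.1 (hcl φ) (1 / (n + 1 : ℝ)) (by positivity)
      exact this
    obtain ⟨i, hi, hi'⟩ := (hs.and this).exists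
    exact ⟨s i, hi, hi'⟩
  choose p hpL hp using hpick
  classical
  -- Whitley's construction: the next vector agrees with `Φ` up to 1/(n+1) on all functionals
  -- collected so far; then functionals norming the enlarged span are added. This reduces the
  -- problem to a sequence.
  let st : ℕ → Finset X × Finset (StrongDual ℝ X) := fun n => Nat.rec (∅, N ∅)
    (fun n q => (insert (p q.2 n) q.1, q.2 ∪ N (insert (p q.2 n) q.1))) n
  have hst : ∀ n, st (n + 1) =
      (insert (p (st n).2 n) (st n).1, (st n).2 ∪ N (insert (p (st n).2 n) (st n).1)) :=
    fun n => rfl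
  have hmono1 : Monotone fun n => (st n).1 := monotone_nat_of_le_succ fun n => by
    simp only [hst]; exact Finset.subset_insert _ _
  have hmono2 : Monotone fun n => (st n).2 := monotone_nat_of_le_succ fun n => by
    simp only [hst]; exact Finset.subset_union_left
  have hnorm : ∀ n, N (st n).1 ⊆ (st n).2 := by
    rintro (_ | n)
    · exact subset_rfl
    · simp only [hst]; exact Finset.subset_union_right
  let a : ℕ → X := fun n => p (st n).2 n
  have ha : ∀ n, a n ∈ (st (n + 1)).1 := fun n => by
    simp only [hst]; exact Finset.mem_insert_self _ _
  obtain ⟨x, hx⟩ := exists_forall_tendsto_of_mem_convexHull hL (hyperfilter ℕ) a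
    fun n => hpL _ _
  have hxΦ : ∀ n, ∀ φ ∈ (st n).2, φ x = Φ φ := by
    intro n φ hφ
    refine tendsto_nhds_unique (hx φ) (Tendsto.mono_left ?_ Nat.hyperfilter_le_atTop)
    rw [tendsto_iff_dist_tendsto_zero]
    refine squeeze_zero' (Eventually.of_forall fun _ => dist_nonneg) ?_
      tendsto_one_div_add_atTop_nhds_zero_nat
    filter_upwards [eventually_ge_atTop n] with m hm
    exact (hp _ _ φ (hmono2 hm hφ)).le
  let Y := Submodule.span ℝ (⋃ n, ((st n).1 : Set X))
  have hxY : x ∈ closure (Y : Set X) := by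
    refine mem_of_forall_tendsto Y.convex.closure isClosed_closure
      (Eventually.of_forall fun n => ?_) hx
    exact subset_closure (Submodule.subset_span (mem_iUnion.2 ⟨n + 1, ha n⟩))
  -- `Φ` and `J x` agree on the collected functionals. For `y` in one of the spans these give ‖Φ - J
  -- y‖ ≤ 2‖x - y‖, whence ‖Φ - J x‖ ≤ 3‖x - y‖, and `y` can be taken arbitrarily close to `x`.
  have hzero : ‖Φ - J x‖ ≤ 0 := by
    refine le_of_forall_pos_le_add fun ε hε => ?_
    obtain ⟨y, hy, hxy⟩ := Metric.mem_closure_iff.1 hxY (ε / 3) (by positivity)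
    rw [dist_eq_norm] at hxy
    have hy' : ∃ n, y ∈ Submodule.span ℝ ((st n).1 : Set X) := by
      have hdir : Directed (· ≤ ·) fun n => Submodule.span ℝ ((st n).1 : Set X) :=
        Monotone.directed_le fun i j hij => Submodule.span_mono (Finset.coe_subset.2 (hmono1 hij))
      rw [← Submodule.mem_iSup_of_directed _ hdir, ← Submodule.span_iUnion]
      exact hy
    obtain ⟨n, hn⟩ := hy'
    obtain ⟨φ, hφ, hφ1, hle⟩ := hN _ y hn
    rw [← hxΦ n φ (hnorm n hφ), ← map_sub] at hle
    have h1 : |φ (x - y)| ≤ ‖x - y‖ := by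
      have := φ.le_of_opNorm_le hφ1 (x - y)
      rwa [one_mul] at this
    have h2 : ‖J y - J x‖ ≤ ‖x - y‖ := by
      rw [← map_sub, norm_sub_rev x y]
      exact NormedSpace.double_dual_bound ℝ X (y - x)
    have hadd : Φ - J x = (Φ - J y) + (J y - J x) := by ext φ; simp
    have htri : ‖Φ - J x‖ ≤ ‖Φ - J y‖ + ‖J y - J x‖ := hadd ▸ ContinuousLinearMap.opNorm_add_le _ _
    calc ‖Φ - J x‖ ≤ ‖Φ - J y‖ + ‖J y - J x‖ := htri
      _ ≤ 0 + ε := by linarith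
  refine ⟨x, fun φ => ?_⟩
  have : c φ = φ x := by
    have := (Φ - J x).le_of_opNorm_le hzero φ
    rw [zero_mul, norm_le_zero_iff] at this
    exact sub_eq_zero.1 this
  rw [← this]
  exact hcl φ

/-- A weak limit along an ultrafilter exists if it exists up to arbitrarily small errors in norm. -/
theorem exists_forall_tendsto_of_approx [CompleteSpace X] {ι : Type*} (F : Ultrafilter ι)
    (s : ι → X) (h : ∀ ε > 0, ∃ L : Set X, IsCompact (toWeakSpace ℝ X '' L) ∧ ∃ a : ι → X,
      ∀ᶠ i in (F : Filter ι), a i ∈ convexHull ℝ L ∧ ‖s i - a i‖ ≤ ε) :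
    ∃ x, ∀ φ : StrongDual ℝ X, Tendsto (fun i => φ (s i)) F (𝓝 (φ x)) := by
  have hpos : ∀ k : ℕ, (0 : ℝ) < 1 / (k + 1) := fun k => by positivity
  choose L hL a ha using fun k : ℕ => h (1 / (k + 1)) (hpos k)
  choose y hy using fun k => exists_forall_tendsto_of_convexHull_mem (hL k) F (a k)
    ((ha k).mono fun i hi => hi.1)
  -- Both `a k` and `a l` are close to `s` along `F`, and norm balls are weakly closed, so the weak
  -- limits inherit the bound.
  have hyd : ∀ k l, ‖y k - y l‖ ≤ 1 / (k + 1 : ℝ) + 1 / (l + 1 : ℝ) := by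
    intro k l
    have : y k - y l ∈ Metric.closedBall (0 : X) (1 / (k + 1 : ℝ) + 1 / (l + 1 : ℝ)) := by
      refine mem_of_forall_tendsto (F := (F : Filter ι)) (a := fun i => a k i - a l i)
        (convex_closedBall _ _) Metric.isClosed_closedBall ?_ fun φ => ?_
      · filter_upwards [ha k, ha l] with i hk hl
        rw [mem_closedBall_zero_iff]
        have := norm_sub_le (s i - a l i) (s i - a k i)
        rw [sub_sub_sub_cancel_left] at this
        linarith [hk.2, hl.2]
      · simpa only [map_sub] using (hy k φ).sub (hy l φ)
    simpa using this
  have hc : CauchySeq y := by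
    refine cauchySeq_of_le_tendsto_0 (fun n : ℕ => 1 / (n + 1 : ℝ) + 1 / (n + 1 : ℝ))
      (fun n m K hn hm => ?_) ?_
    · rw [dist_eq_norm]
      exact (hyd n m).trans (add_le_add (Nat.one_div_le_one_div hn) (Nat.one_div_le_one_div hm))
    · simpa using (tendsto_one_div_add_atTop_nhds_zero_nat (𝕜 := ℝ)).add
        (tendsto_one_div_add_atTop_nhds_zero_nat (𝕜 := ℝ))
  obtain ⟨x, hx⟩ := cauchySeq_tendsto_of_complete hc
  refine ⟨x, fun φ => Metric.tendsto_nhds.2 fun ε hε => ?_⟩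
  have h1 : ∀ᶠ k in atTop, dist (φ (y k)) (φ x) < ε / 3 :=
    Metric.tendsto_nhds.1 ((φ.continuous.tendsto x).comp hx) _ (by positivity)
  have h2 : ∀ᶠ k : ℕ in atTop, ‖φ‖ * (1 / (k + 1 : ℝ)) < ε / 3 := by
    have := (tendsto_one_div_add_atTop_nhds_zero_nat (𝕜 := ℝ)).const_mul ‖φ‖
    rw [mul_zero] at this
    exact this.eventually (gt_mem_nhds (by positivity))
  obtain ⟨k, hk1, hk2⟩ := (h1.and h2).exists
  filter_upwards [ha k, Metric.tendsto_nhds.1 (hy k φ) (ε / 3) (by positivity)] with i hi hi'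
  have h3 : dist (φ (s i)) (φ (a k i)) ≤ ‖φ‖ * (1 / (k + 1 : ℝ)) := by
    rw [dist_eq_norm, ← map_sub]
    exact φ.le_opNorm_of_le hi.2
  have := dist_triangle4 (φ (s i)) (φ (a k i)) (φ (y k)) (φ x)
  linarith

end WeakCompactness

/-! ### Sierpiński's theorem on atomless sets -/

section Atomless

variable {Ω : Type*} [MeasurableSpace Ω] {μ : Measure Ω}

/-- `Δ` contains no atom of `μ`. -/
def IsAtomlessOn (μ : Measure Ω) (Δ : Set Ω) : Prop :=
  ∀ D ⊆ Δ, ¬ IsMeasureAtom μ D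

theorem IsAtomlessOn.mono {Δ Δ' : Set Ω} (h : IsAtomlessOn μ Δ) (hs : Δ' ⊆ Δ) :
    IsAtomlessOn μ Δ' := fun D hD => h D (hD.trans hs)

/-- A set that is not an atom splits into two non-null parts; the lighter one has at most half the
mass. -/
theorem IsAtomlessOn.exists_half {Δ D : Set Ω} (h : IsAtomlessOn μ Δ) (hD : D ⊆ Δ)
    (hDm : MeasurableSet D) (hD0 : μ D ≠ 0) :
    ∃ B ⊆ D, MeasurableSet B ∧ μ B ≠ 0 ∧ μ B ≤ μ D / 2 := by
  have := h D hD
  simp only [IsMeasureAtom, hDm, hD0, ne_eq, not_false_eq_true, true_and] at this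
  push Not at this
  obtain ⟨B, hB, hBm, hB0, hB1⟩ := this
  have hadd : μ B + μ (D \ B) = μ D := by
    rw [measure_add_sdiff hBm.nullMeasurableSet, union_eq_self_of_subset_left hB]
  rcases le_total (μ B) (μ (D \ B)) with hle | hle
  · refine ⟨B, hB, hBm, hB0, ?_⟩
    rw [ENNReal.le_div_iff_mul_le (by simp) (by simp), mul_two, ← hadd]
    gcongr
  · refine ⟨D \ B, sdiff_subset, hDm.diff hBm, hB1, ?_⟩
    rw [ENNReal.le_div_iff_mul_le (by simp) (by simp), mul_two, ← hadd]
    gcongr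

theorem IsAtomlessOn.exists_small [IsFiniteMeasure μ] {Δ D : Set Ω} (h : IsAtomlessOn μ Δ)
    (hD : D ⊆ Δ) (hDm : MeasurableSet D) (hD0 : μ D ≠ 0) {ε : ℝ≥0∞} (hε : ε ≠ 0) :
    ∃ B ⊆ D, MeasurableSet B ∧ μ B ≠ 0 ∧ μ B ≤ ε := by
  have key : ∀ n : ℕ, ∃ B ⊆ D, MeasurableSet B ∧ μ B ≠ 0 ∧ μ B ≤ μ D * (2⁻¹) ^ n := by
    intro n
    induction n with
    | zero => exact ⟨D, subset_rfl, hDm, hD0, by simp⟩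
    | succ n ih =>
      obtain ⟨B, hB, hBm, hB0, hle⟩ := ih
      obtain ⟨B', hB', hBm', hB0', hle'⟩ := h.exists_half (hB.trans hD) hBm hB0
      refine ⟨B', hB'.trans hB, hBm', hB0', hle'.trans ?_⟩
      rw [pow_succ, ← mul_assoc, ENNReal.div_eq_inv_mul, mul_comm]
      gcongr
  have hlim : Tendsto (fun n : ℕ => μ D * (2⁻¹ : ℝ≥0∞) ^ n) atTop (𝓝 (μ D * 0)) :=
    ENNReal.Tendsto.const_mul
      (ENNReal.tendsto_pow_atTop_nhds_zero_of_lt_one (by norm_num)) (Or.inr (measure_ne_top _ _))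
  rw [mul_zero] at hlim
  obtain ⟨n, hn⟩ := (hlim.eventually_lt_const (pos_iff_ne_zero.2 hε)).exists
  obtain ⟨B, hB, hBm, hB0, hle⟩ := key n
  exact ⟨B, hB, hBm, hB0, hle.trans hn.le⟩

/-- Sierpiński's theorem: an atomless finite measure takes all intermediate values. -/
theorem IsAtomlessOn.exists_measure_eq [IsFiniteMeasure μ] {Δ : Set Ω} (h : IsAtomlessOn μ Δ)
    (hΔ : MeasurableSet Δ) {c : ℝ≥0∞} (hc : c ≤ μ Δ) :
    ∃ B ⊆ Δ, MeasurableSet B ∧ μ B = c := by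
  have hct : c ≠ ∞ := ne_top_of_le_ne_top (measure_ne_top _ _) hc
  let adm : Set Ω → Set (Set Ω) := fun B => {C | C ⊆ Δ \ B ∧ MeasurableSet C ∧ μ B + μ C ≤ c}
  -- Greedy choice: `C` takes at least half of the largest mass that can still be added to `B`
  -- without exceeding `c`.
  have hstep : ∀ B : Set Ω, ∃ C, μ B ≤ c → C ∈ adm B ∧ ∀ C' ∈ adm B, μ C' / 2 ≤ μ C := by
    intro B
    by_cases hB : μ B ≤ c
    · have hemp : ∅ ∈ adm B := ⟨empty_subset _, MeasurableSet.empty, by simpa using hB⟩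
      let s : ℝ≥0∞ := ⨆ C ∈ adm B, μ C
      have hs : ∀ C ∈ adm B, μ C ≤ s := fun C hC => le_iSup₂ (f := fun C _ => μ C) C hC
      rcases eq_or_ne s 0 with hs0 | hs0
      · exact ⟨∅, fun _ => ⟨hemp, fun C' hC' => by
          have : μ C' = 0 := le_antisymm (hs0 ▸ hs C' hC') zero_le
          simp [this]⟩⟩
      · have hst : s ≠ ∞ := ne_top_of_le_ne_top (measure_ne_top μ univ)
          (iSup₂_le fun C _ => measure_mono (subset_univ C))
        obtain ⟨C, hC⟩ := lt_iSup_iff.1 (ENNReal.half_lt_self hs0 hst : s / 2 < s)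
        obtain ⟨hC1, hC2⟩ := lt_iSup_iff.1 hC
        exact ⟨C, fun _ => ⟨hC1, fun C' hC' =>
          (ENNReal.div_le_div_right (hs C' hC') 2).trans hC2.le⟩⟩
    · exact ⟨∅, fun h => absurd h hB⟩
  choose C hC using hstep
  let B : ℕ → Set Ω := fun n => Nat.rec ∅ (fun _ B => B ∪ C B) n
  have hB1 : ∀ n, B (n + 1) = B n ∪ C (B n) := fun n => rfl
  have hBmono : Monotone B := monotone_nat_of_le_succ fun n => subset_union_left
  have hBp : ∀ n, B n ⊆ Δ ∧ MeasurableSet (B n) ∧ μ (B n) ≤ c := by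
    intro n
    induction n with
    | zero => exact ⟨empty_subset _, MeasurableSet.empty, by simp [B]⟩
    | succ n ih =>
      obtain ⟨⟨h1, h2, h3⟩, -⟩ := hC (B n) ih.2.2
      rw [hB1]
      exact ⟨union_subset ih.1 (h1.trans sdiff_subset), ih.2.1.union h2,
        (measure_union_le _ _).trans h3⟩
  have hUm : MeasurableSet (⋃ n, B n) := MeasurableSet.iUnion fun n => (hBp n).2.1
  have hUs : ⋃ n, B n ⊆ Δ := iUnion_subset fun n => (hBp n).1
  have hUc : μ (⋃ n, B n) ≤ c := by
    rw [hBmono.measure_iUnion]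
    exact iSup_le fun n => (hBp n).2.2
  refine ⟨⋃ n, B n, hUs, hUm, hUc.antisymm ?_⟩
  by_contra hlt
  rw [not_le] at hlt
  have hrest : μ (Δ \ ⋃ n, B n) ≠ 0 := by
    intro h0
    rw [measure_sdiff hUs hUm.nullMeasurableSet (measure_ne_top _ _), tsub_eq_zero_iff_le] at h0
    exact absurd (hc.trans h0) (not_le.2 hlt)
  -- If the union falls short of `c`, a small non-null `D` outside it stays admissible at every
  -- step, so each step adds at least μ D / 2, which is impossible.
  obtain ⟨D, hD, hDm, hD0, hDle⟩ := h.exists_small sdiff_subset (hΔ.diff hUm) hrest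
    (tsub_pos_of_lt hlt).ne'
  have hDadm : ∀ n, D ∈ adm (B n) := fun n => by
    refine ⟨hD.trans (sdiff_subset_sdiff_right (subset_iUnion B n)), hDm, ?_⟩
    calc μ (B n) + μ D ≤ μ (⋃ n, B n) + (c - μ (⋃ n, B n)) := by
          gcongr
          exact subset_iUnion B n
      _ = c := add_tsub_cancel_of_le hUc
  have hlow : ∀ n : ℕ, n * (μ D / 2) ≤ μ (B n) := by
    intro n
    induction n with
    | zero => simp
    | succ n ih =>
      obtain ⟨⟨h1, h2, -⟩, h4⟩ := hC (B n) (hBp n).2.2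
      have hdisj : Disjoint (B n) (C (B n)) :=
        (disjoint_sdiff_left.mono_left h1).symm
      rw [hB1, measure_union hdisj h2, Nat.cast_succ, add_mul, one_mul]
      exact add_le_add ih (h4 D (hDadm n))
  obtain ⟨n, hn⟩ := ENNReal.exists_nat_mul_gt (ENNReal.half_pos hD0).ne' hct
  exact absurd ((hlow n).trans (hBp n).2.2) (not_le.2 hn)

/-- An atomless set can be cut into disjoint pieces of prescribed measures. -/
theorem IsAtomlessOn.exists_disjoint [IsFiniteMeasure μ] {Δ : Set Ω} (h : IsAtomlessOn μ Δ)
    (hΔ : MeasurableSet Δ) (w : ℕ → ℝ≥0∞) (hw : ∑' n, w n ≤ μ Δ) :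
    ∃ D : ℕ → Set Ω, (∀ n, D n ⊆ Δ) ∧ (∀ n, MeasurableSet (D n)) ∧ (∀ n, μ (D n) = w n) ∧
      Pairwise (Function.onFun Disjoint D) := by
  have hstep : ∀ (U : Set Ω) (c : ℝ≥0∞), ∃ B, MeasurableSet U → c ≤ μ (Δ \ U) →
      B ⊆ Δ \ U ∧ MeasurableSet B ∧ μ B = c := by
    intro U c
    by_cases hU : MeasurableSet U ∧ c ≤ μ (Δ \ U)
    · obtain ⟨B, hB⟩ := (h.mono sdiff_subset).exists_measure_eq (hΔ.diff hU.1) hU.2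
      exact ⟨B, fun _ _ => hB⟩
    · exact ⟨∅, fun h1 h2 => absurd ⟨h1, h2⟩ hU⟩
  choose B hB using hstep
  let U : ℕ → Set Ω := fun n => Nat.rec ∅ (fun n U => U ∪ B U (w n)) n
  have hU1 : ∀ n, U (n + 1) = U n ∪ B (U n) (w n) := fun n => rfl
  have hUmono : Monotone U := monotone_nat_of_le_succ fun n => subset_union_left
  have hle : ∀ n, U n ⊆ Δ → MeasurableSet (U n) → μ (U n) = ∑ i ∈ Finset.range n, w i →
      w n ≤ μ (Δ \ U n) := by
    intro n h1 h2 h3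
    rw [measure_sdiff h1 h2.nullMeasurableSet (measure_ne_top _ _)]
    refine ENNReal.le_sub_of_add_le_left (measure_ne_top _ _) ?_
    rw [h3, ← Finset.sum_range_succ]
    exact (ENNReal.sum_le_tsum _).trans hw
  have hUp : ∀ n, U n ⊆ Δ ∧ MeasurableSet (U n) ∧ μ (U n) = ∑ i ∈ Finset.range n, w i := by
    intro n
    induction n with
    | zero => exact ⟨empty_subset _, MeasurableSet.empty, by simp [U]⟩
    | succ n ih =>
      obtain ⟨h1, h2, h3⟩ := hB (U n) (w n) ih.2.1 (hle n ih.1 ih.2.1 ih.2.2)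
      have hdisj : Disjoint (U n) (B (U n) (w n)) := (disjoint_sdiff_left.mono_left h1).symm
      rw [hU1]
      refine ⟨union_subset ih.1 (h1.trans sdiff_subset), ih.2.1.union h2, ?_⟩
      rw [measure_union hdisj h2, h3, ih.2.2, Finset.sum_range_succ]
  have hD : ∀ n, B (U n) (w n) ⊆ Δ \ U n ∧ MeasurableSet (B (U n) (w n)) ∧
      μ (B (U n) (w n)) = w n := fun n =>
    hB (U n) (w n) (hUp n).2.1 (hle n (hUp n).1 (hUp n).2.1 (hUp n).2.2)
  have hlt : ∀ m n, m < n → Disjoint (B (U m) (w m)) (B (U n) (w n)) := by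
    intro m n hmn
    have h1 : B (U m) (w m) ⊆ U n := by
      refine subset_trans ?_ (hUmono (Nat.succ_le_of_lt hmn))
      rw [hU1]
      exact subset_union_right
    exact (disjoint_sdiff_left.mono_left (hD n).1).symm.mono_left h1
  exact ⟨fun n => B (U n) (w n), fun n => (hD n).1.trans sdiff_subset, fun n => (hD n).2.1,
    fun n => (hD n).2.2, fun m n hmn => hmn.lt_or_gt.elim (hlt m n) fun h => (hlt n m h).symm⟩

end Atomless

/-! ### Cells with prescribed sampling points and measures -/

section Retraction

variable {Ω : Type*} [MeasurableSpace Ω] {μ : Measure Ω}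

/-- Any two different points of `E` are separated by a measurable set. -/
def IsSeparatedSet (E : Set Ω) : Prop :=
  ∀ s ∈ E, ∀ t ∈ E, s ≠ t → ∃ M, MeasurableSet M ∧ s ∈ M ∧ t ∉ M

theorem IsSeparatedSet.mono {E E' : Set Ω} (h : IsSeparatedSet E) (hE : E' ⊆ E) :
    IsSeparatedSet E' := fun s hs t ht => h s (hE hs) t (hE ht)

/-- Countably many separated points have pairwise disjoint measurable neighbourhoods. -/
theorem IsSeparatedSet.exists_disjoint {Q : Set Ω} (hQ : IsSeparatedSet Q) (hc : Q.Countable) :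
    ∃ N : Ω → Set Ω, (∀ t ∈ Q, t ∈ N t) ∧ (∀ t, MeasurableSet (N t)) ∧ Q.PairwiseDisjoint N := by
  have : ∀ s t, ∃ M, MeasurableSet M ∧ (s ∈ Q → t ∈ Q → s ≠ t → s ∈ M ∧ t ∉ M) := by
    intro s t
    by_cases h : s ∈ Q ∧ t ∈ Q ∧ s ≠ t
    · obtain ⟨M, hM, h1⟩ := hQ s h.1 t h.2.1 h.2.2
      exact ⟨M, hM, fun _ _ _ => h1⟩
    · exact ⟨∅, MeasurableSet.empty, fun h1 h2 h3 => absurd ⟨h1, h2, h3⟩ h⟩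
  choose M hM hMs using this
  -- Removing `M s t` from `M t s` makes the construction antisymmetric in `s` and `t`, which yields
  -- disjointness.
  refine ⟨fun t => ⋂ s ∈ Q \ {t}, M t s \ M s t, fun t ht => ?_, fun t => ?_, ?_⟩
  · refine mem_iInter₂.2 fun s hs => ⟨(hMs t s ht hs.1 (Ne.symm hs.2)).1, ?_⟩
    exact (hMs s t hs.1 ht hs.2).2
  · exact MeasurableSet.biInter (hc.mono sdiff_subset) fun s _ => (hM t s).diff (hM s t)
  · intro s hs t ht hst
    rw [Function.onFun, Set.disjoint_left]
    intro x hxs hxt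
    exact (mem_iInter₂.1 hxt s ⟨hs, hst⟩).2 (mem_iInter₂.1 hxs t ⟨ht, hst.symm⟩).1

/-- `ρ` retracts `Δ` onto countably many sampling points, with measurable fibres whose measures
are given by `w`. -/
structure IsSamplingRetraction (μ : Measure Ω) (Δ : Set Ω) (w : Ω → ℝ≥0∞) (ρ : Ω → Ω) :
    Prop where
  mapsTo : ∀ s ∈ Δ, ρ s ∈ Δ
  idem : ∀ s ∈ Δ, ρ (ρ s) = ρ s
  countable : (ρ '' Δ).Countable
  measurableSet : ∀ t, MeasurableSet (Δ ∩ ρ ⁻¹' {t})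
  measure_eq : ∀ t ∈ Δ, μ (Δ ∩ ρ ⁻¹' {t}) = w t

theorem isSamplingRetraction_const {Δ : Set Ω} (hΔ : MeasurableSet Δ) {w : Ω → ℝ≥0∞} {t₀ : Ω}
    (ht₀ : t₀ ∈ Δ) (hw₀ : w t₀ = μ Δ) (hw : ∀ t ∈ Δ, t ≠ t₀ → w t = 0) :
    IsSamplingRetraction μ Δ w fun _ => t₀ where
  mapsTo _ _ := ht₀
  idem _ _ := rfl
  countable := (countable_singleton t₀).mono (by rintro - ⟨_, _, rfl⟩; rfl)
  measurableSet t := by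
    by_cases h : t₀ = t
    · simpa [preimage_const, h] using hΔ
    · simp [h]
  measure_eq t ht := by
    rcases eq_or_ne t t₀ with rfl | h
    · have : (fun _ : Ω => t) ⁻¹' {t} = univ := by ext; simp
      rw [this, inter_univ, hw₀]
    · have : (fun _ : Ω => t₀) ⁻¹' {t} = ∅ := by ext; simp [h.symm]
      rw [this, inter_empty, measure_empty, hw t ht h]

/-- Only countably many points carry weight, and each has outer measure zero, so they have disjoint
measurable null neighbourhoods. The fibre of such a point is its neighbourhood together with a piece
of the prescribed measure cut from the rest of the cell. -/
theorem exists_isSamplingRetraction_of_isAtomlessOn [IsFiniteMeasure μ] {Δ : Set Ω}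
    (hΔ : MeasurableSet Δ) (hΔ0 : μ Δ ≠ 0) (ha : IsAtomlessOn μ Δ) {w : Ω → ℝ≥0∞}
    (hw : ∑' t, Δ.indicator w t = μ Δ)
    (hsep : IsSeparatedSet (Function.support (Δ.indicator w)))
    (h0 : ∀ t ∈ Function.support (Δ.indicator w), μ {t} = 0) :
    ∃ ρ, IsSamplingRetraction μ Δ w ρ := by
  set Q := Function.support (Δ.indicator w) with hQdef
  have hQΔ : Q ⊆ Δ := support_indicator_subset
  have hQc : Q.Countable := Summable.countable_support_ennreal (hw ▸ measure_ne_top _ _)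
  have hQw : ∀ t ∈ Δ, t ∉ Q → w t = 0 := fun t ht htQ => by
    simpa [hQdef, ht] using htQ
  obtain ⟨N', hN'mem, hN'm, hN'd⟩ := hsep.exists_disjoint hQc
  let N : Ω → Set Ω := fun t => N' t ∩ (toMeasurable μ {t} ∩ Δ)
  have hNm : ∀ t, MeasurableSet (N t) := fun t =>
    (hN'm t).inter ((measurableSet_toMeasurable _ _).inter hΔ)
  have hNmem : ∀ t ∈ Q, t ∈ N t := fun t ht =>
    ⟨hN'mem t ht, subset_toMeasurable μ {t} rfl, hQΔ ht⟩
  have hN0 : ∀ t ∈ Q, μ (N t) = 0 := fun t ht => by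
    refine measure_mono_null (inter_subset_right.trans inter_subset_left) ?_
    rw [measure_toMeasurable, h0 t ht]
  have hNd : ∀ s ∈ Q, ∀ t ∈ Q, s ≠ t → Disjoint (N s) (N t) := fun s hs t ht hst =>
    (hN'd hs ht hst).mono inter_subset_left inter_subset_left
  let G : Set Ω := ⋃ t ∈ Q, N t
  have hGm : MeasurableSet G := MeasurableSet.biUnion hQc fun t _ => hNm t
  have hG0 : μ G = 0 := (measure_biUnion_null_iff hQc).2 hN0
  have hΔG : μ (Δ \ G) = μ Δ := measure_sdiff_null hG0
  have : Countable Q := hQc.to_subtype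
  obtain ⟨e, he⟩ := exists_injective_nat Q
  have hsumQ : ∑' t : Q, w t = μ Δ := by
    rw [← hw, ← tsum_subtype_eq_of_support_subset (s := Q) subset_rfl]
    exact tsum_congr fun t => (indicator_of_mem (hQΔ t.2) w).symm
  obtain ⟨D', hD's, hD'm, hD'w, hD'd⟩ := (ha.mono sdiff_subset).exists_disjoint (hΔ.diff hGm)
    (Function.extend e (fun q : Q => w q) 0) (by rw [tsum_extend_zero he, hsumQ, hΔG])
  let D : Q → Set Ω := fun q => D' (e q)
  have hDw : ∀ q : Q, μ (D q) = w q := fun q => by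
    simp only [D, hD'w, he.extend_apply]
  have hDd : ∀ p q : Q, p ≠ q → Disjoint (D p) (D q) := fun p q hpq => hD'd (he.ne hpq)
  have hDN : ∀ p q : Q, Disjoint (D p) (N q) := fun p q =>
    disjoint_sdiff_left.mono (hD's _) (subset_biUnion_of_mem q.2)
  let P : Q → Set Ω := fun q => N q ∪ D q
  have hPd : ∀ p q : Q, p ≠ q → Disjoint (P p) (P q) := fun p q hpq => by
    simp only [P, disjoint_union_left, disjoint_union_right]
    exact ⟨⟨hNd _ p.2 _ q.2 (Subtype.coe_ne_coe.2 hpq), hDN p q⟩, (hDN q p).symm, hDd p q hpq⟩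
  have hPm : ∀ q, MeasurableSet (P q) := fun q => (hNm q).union (hD'm _)
  have hPΔ : ∀ q, P q ⊆ Δ := fun q =>
    union_subset (inter_subset_right.trans inter_subset_right) ((hD's _).trans sdiff_subset)
  have hPw : ∀ q : Q, μ (P q) = w q := fun q => by
    rw [← hDw]
    refine le_antisymm ((measure_union_le _ _).trans ?_) (measure_mono subset_union_right)
    rw [hN0 _ q.2, zero_add]
  -- The leftover is null, so it can be sent to any one sampling point `q₀` without changing a
  -- measure.
  let R : Set Ω := Δ \ ⋃ q, P q
  have hRm : MeasurableSet R := hΔ.diff (MeasurableSet.iUnion hPm)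
  have hR0 : μ R = 0 := by
    have h1 : μ (⋃ q, P q) = μ Δ := by
      rw [measure_iUnion (fun p q => hPd p q) hPm, ← hsumQ]
      exact tsum_congr hPw
    rw [measure_sdiff (iUnion_subset hPΔ) (MeasurableSet.iUnion hPm).nullMeasurableSet
      (measure_ne_top _ _), h1, tsub_self]
  have hQne : Nonempty Q := by
    by_contra hne
    rw [not_nonempty_iff] at hne
    exact hΔ0 (by rw [← hsumQ, tsum_empty])
  obtain ⟨q₀⟩ := hQne
  classical
  let ρ : Ω → Ω := fun s => if h : ∃ q, s ∈ P q then (h.choose : Ω) else q₀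
  have hρP : ∀ q : Q, ∀ s ∈ P q, ρ s = q := fun q s hs => by
    have h : ∃ q, s ∈ P q := ⟨q, hs⟩
    simp only [ρ, dif_pos h]
    by_contra hne
    exact Set.disjoint_left.1 (hPd _ q fun h' => hne (congrArg _ h')) h.choose_spec hs
  have hρR : ∀ s ∈ R, ρ s = q₀ := fun s hs => by
    have h : ¬ ∃ q, s ∈ P q := fun h => hs.2 (mem_iUnion.2 h)
    simp only [ρ, dif_neg h]
  have hρQ : ∀ s, ∃ q : Q, ρ s = q := fun s => by
    by_cases h : ∃ q, s ∈ P q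
    · exact ⟨_, dif_pos h⟩
    · exact ⟨_, dif_neg h⟩
  have hfix : ∀ q : Q, ρ q = q := fun q => hρP q q (Or.inl (hNmem _ q.2))
  have hfib : ∀ q : Q, Δ ∩ ρ ⁻¹' {(q : Ω)} = P q ∪ if q = q₀ then R else ∅ := fun q => by
    ext s
    constructor
    · rintro ⟨hsΔ, hs⟩
      by_cases h : ∃ p, s ∈ P p
      · obtain ⟨p, hp⟩ := h
        have : (p : Ω) = q := by rw [← hρP p s hp]; exact hs
        rw [← Subtype.ext this]
        exact Or.inl hp
      · have hsR : s ∈ R := ⟨hsΔ, fun h' => h (mem_iUnion.1 h')⟩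
        have : (q : Ω) = q₀ := by rw [← hρR s hsR]; exact hs.symm
        rw [if_pos (Subtype.ext this)]
        exact Or.inr hsR
    · rintro (hs | hs)
      · exact ⟨hPΔ q hs, hρP q s hs⟩
      · split_ifs at hs with h
        · rw [h]
          exact ⟨hs.1, hρR s hs⟩
        · exact hs.elim
  have hfib' : ∀ t ∉ Q, Δ ∩ ρ ⁻¹' {t} = ∅ := fun t ht => by
    refine eq_empty_of_forall_notMem fun s hs => ht ?_
    obtain ⟨q, hq⟩ := hρQ s
    have : ρ s = t := hs.2
    rw [← this, hq]
    exact q.2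
  refine ⟨ρ, ⟨fun s _ => ?_, fun s _ => ?_, ?_, fun t => ?_, fun t ht => ?_⟩⟩
  · obtain ⟨q, hq⟩ := hρQ s
    rw [hq]
    exact hQΔ q.2
  · obtain ⟨q, hq⟩ := hρQ s
    rw [hq, hfix]
  · refine hQc.mono ?_
    rintro - ⟨s, -, rfl⟩
    obtain ⟨q, hq⟩ := hρQ s
    rw [hq]
    exact q.2
  · by_cases ht : t ∈ Q
    · rw [hfib ⟨t, ht⟩]
      refine (hPm _).union ?_
      split_ifs
      exacts [hRm, MeasurableSet.empty]
    · rw [hfib' t ht]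
      exact MeasurableSet.empty
  · by_cases htQ : t ∈ Q
    · rw [hfib ⟨t, htQ⟩]
      refine le_antisymm ((measure_union_le _ _).trans ?_) ?_
      · rw [hPw]
        split_ifs <;> simp [hR0]
      · rw [← hPw ⟨t, htQ⟩]
        exact measure_mono subset_union_left
    · rw [hfib' t htQ, measure_empty, hQw t ht htQ]

/-- The condition on a cell `Δ` and a set `E` of admissible sampling points under which all
admissible weights on `Δ` come from an integral sum. -/
def IsGoodCell (μ : Measure Ω) (E Δ : Set Ω) : Prop :=
  (IsAtomlessOn μ Δ ∧ ∀ t ∈ E ∩ Δ, μ {t} = 0) ∨ (E ∩ Δ).Subsingleton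

theorem IsGoodCell.mono {E E' Δ Δ' : Set Ω} (h : IsGoodCell μ E Δ) (hE : E' ⊆ E) (hΔ : Δ' ⊆ Δ) :
    IsGoodCell μ E' Δ' :=
  h.imp (fun h => ⟨h.1.mono hΔ, fun t ht => h.2 t ⟨hE ht.1, hΔ ht.2⟩⟩)
    fun h => h.anti (inter_subset_inter hE hΔ)

/-- In a null cell all weights vanish and any point will do. In a non-null cell with at most one
admissible point, that point carries the whole mass. The atomless case has its own lemma. -/
theorem exists_isSamplingRetraction [IsFiniteMeasure μ] {E Δ : Set Ω} (hΔ : MeasurableSet Δ)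
    (hE : IsSeparatedSet E) (hEΔ : IsGoodCell μ E Δ) {w : Ω → ℝ≥0∞} (hwE : ∀ t ∉ E, w t = 0)
    (hw : ∑' t, Δ.indicator w t = μ Δ) : ∃ ρ, IsSamplingRetraction μ Δ w ρ := by
  rcases eq_or_ne (μ Δ) 0 with h0 | h0
  · rcases Δ.eq_empty_or_nonempty with rfl | ⟨t₀, ht₀⟩
    · exact ⟨id, by simp, by simp, by simp, by simp, by simp⟩
    · have hz : ∀ t ∈ Δ, w t = 0 := fun t ht => by
        rw [h0, ENNReal.tsum_eq_zero] at hw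
        simpa [ht] using hw t
      exact ⟨_, isSamplingRetraction_const hΔ ht₀ (by rw [h0, hz t₀ ht₀]) fun t ht _ => hz t ht⟩
  · have hsE : Function.support (Δ.indicator w) ⊆ E ∩ Δ := fun t ht => by
      rw [support_indicator] at ht
      exact ⟨by_contra fun h => ht.2 (hwE t h), ht.1⟩
    rcases hEΔ with ⟨ha, hμ⟩ | hsub
    · exact exists_isSamplingRetraction_of_isAtomlessOn hΔ h0 ha hw
        (hE.mono (hsE.trans inter_subset_left)) fun t ht => hμ t (hsE ht)
    · obtain ⟨t₀, ht₀⟩ : ∃ t, Δ.indicator w t ≠ 0 := by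
        by_contra! h
        exact h0 (by rw [← hw, ENNReal.tsum_eq_zero.2 h])
      have hz : ∀ t ∈ Δ, t ≠ t₀ → w t = 0 := fun t ht hne => by
        by_contra hwt
        exact hne (hsub (hsE (by rw [support_indicator]; exact ⟨ht, hwt⟩)) (hsE ht₀))
      have ht₀Δ : t₀ ∈ Δ := (hsE ht₀).2
      refine ⟨_, isSamplingRetraction_const hΔ ht₀Δ ?_ hz⟩
      rw [← hw, tsum_eq_single t₀, indicator_of_mem ht₀Δ]
      intro t hne
      by_cases ht : t ∈ Δ
      · rw [indicator_of_mem ht, hz t ht hne]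
      · exact indicator_of_notMem ht w

/-- Sampling retractions of the fibres of a partition glue together. -/
theorem exists_isSamplingRetraction_univ {π : Ω → ℕ} {w : Ω → ℝ≥0∞}
    (h : ∀ n, ∃ ρ, IsSamplingRetraction μ (π ⁻¹' {n}) w ρ) :
    ∃ ρ, IsSamplingRetraction μ univ w ρ ∧ ∀ s, π (ρ s) = π s := by
  choose σ hσ using h
  have hπ : ∀ s, π (σ (π s) s) = π s := fun s => (hσ (π s)).mapsTo s rfl
  have hfib : ∀ t, univ ∩ (fun s => σ (π s) s) ⁻¹' {t} = π ⁻¹' {π t} ∩ σ (π t) ⁻¹' {t} := by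
    intro t
    ext s
    simp only [univ_inter, mem_preimage, mem_singleton_iff, mem_inter_iff]
    constructor
    · intro hs
      have : π t = π s := by rw [← hs, hπ]
      exact ⟨this.symm, by rw [this, hs]⟩
    · rintro ⟨h1, h2⟩
      rw [h1, h2]
  refine ⟨fun s => σ (π s) s, ⟨fun _ _ => mem_univ _, fun s _ => ?_, ?_, fun t => ?_,
    fun t _ => ?_⟩, hπ⟩
  · simp only [hπ]
    exact (hσ (π s)).idem s rfl
  · refine (countable_iUnion fun n => (hσ n).countable).mono ?_
    rintro - ⟨s, -, rfl⟩
    exact mem_iUnion.2 ⟨π s, s, rfl, rfl⟩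
  · rw [hfib]
    exact (hσ _).measurableSet t
  · rw [hfib]
    exact (hσ _).measure_eq t rfl

end Retraction

/-! ### From retractions to integral sums -/

section IntegralSum

variable {Ω : Type*} [MeasurableSpace Ω] {μ : Measure Ω}
  {X : Type*} [NormedAddCommGroup X] [NormedSpace ℝ X]

/-- The partition into the fibres of a sampling retraction. -/
def IsSamplingRetraction.partition {w : Ω → ℝ≥0∞} {ρ : Ω → Ω}
    (h : IsSamplingRetraction μ univ w ρ) : CountablePartition Ω where
  cells := (fun t => ρ ⁻¹' {t}) '' range ρ
  countable := by
    rw [← image_univ]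
    exact h.countable.image _
  measurableSet := by
    rintro - ⟨t, -, rfl⟩
    simpa using h.measurableSet t
  isPartition := by
    refine ⟨?_, fun s => ⟨ρ ⁻¹' {ρ s}, ⟨⟨ρ s, ⟨s, rfl⟩, rfl⟩, rfl⟩, ?_⟩⟩
    · rintro ⟨-, ⟨s, rfl⟩, hs⟩
      exact notMem_empty s (hs ▸ (rfl : ρ s = ρ s))
    · rintro - ⟨⟨t, -, rfl⟩, hs⟩
      have : ρ s = t := hs
      simp only [this]

/-- A sampling retraction gives an integral sum with the prescribed weights. -/
theorem IsSamplingRetraction.exists_sampling {w : Ω → ℝ≥0∞} {ρ : Ω → Ω}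
    (h : IsSamplingRetraction μ univ w ρ) {f : Ω → X}
    (hs : Summable fun t => ‖(w t).toReal • f t‖) {x : X}
    (hx : HasSum (fun t => (w t).toReal • f t) x) :
    ∃ T : h.partition.cells → Ω, IsSampling h.partition T ∧ IsAbsoluteSum μ f h.partition T ∧
      integralSum μ f h.partition T = x := by
  have hfix : ∀ t ∈ range ρ, ρ t = t := by
    rintro - ⟨s, rfl⟩
    exact h.idem s (mem_univ s)
  have hinj : InjOn (fun t => ρ ⁻¹' {t}) (range ρ) := fun s hs t ht hst => by
    have : s ∈ ρ ⁻¹' {t} := by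
      have h1 : s ∈ ρ ⁻¹' {s} := hfix s hs
      exact (show ρ ⁻¹' {s} = ρ ⁻¹' {t} from hst) ▸ h1
    exact (hfix s hs).symm.trans this
  let e : range ρ ≃ h.partition.cells := Equiv.Set.imageOfInjOn _ _ hinj
  let T : h.partition.cells → Ω := fun D => (e.symm D : Ω)
  have hmeas : ∀ t : range ρ, μ.real (e t : Set Ω) = (w t).toReal := fun t => by
    rw [← h.measure_eq t (mem_univ _), univ_inter]
    rfl
  have hterm : (sumTerm μ f h.partition T) ∘ e = (fun t => (w t).toReal • f t) ∘ Subtype.val := by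
    funext t
    simp only [Function.comp_apply, sumTerm, T, Equiv.symm_apply_apply, hmeas]
  -- A point outside the range has an empty fibre, hence no weight, so the sum over all points is a
  -- sum over cells.
  have hsupp : ∀ t ∉ range ρ, w t = 0 := fun t ht => by
    rw [← h.measure_eq t (mem_univ _), univ_inter, preimage_singleton_eq_empty.2 ht, measure_empty]
  have hs2 : Function.support (fun t => (w t).toReal • f t) ⊆ range ρ := fun t ht => by
    by_contra hn
    exact ht (by simp [hsupp t hn])
  refine ⟨T, ?_, ?_, ?_⟩
  · intro D
    obtain ⟨t, rfl⟩ := e.surjective D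
    simp only [T, Equiv.symm_apply_apply]
    exact hfix t t.2
  · rw [IsAbsoluteSum, ← e.summable_iff]
    have := hs.comp_injective (Subtype.val_injective (p := (· ∈ range ρ)))
    refine this.congr fun t => ?_
    exact congrArg norm (congrFun hterm t).symm
  · refine HasSum.tsum_eq ?_
    rw [← e.hasSum_iff, hterm]
    exact (hasSum_subtype_iff_of_support_subset hs2).2 hx

/-- Coding a partition by a measurable ℕ-valued function turns common refinement into `Nat.pair`. -/
theorem CountablePartition.exists_index (P : CountablePartition Ω) :
    ∃ π : Ω → ℕ, Measurable π ∧ ∀ s t, π s = π t → ∃ E ∈ P.cells, s ∈ E ∧ t ∈ E := by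
  have : Countable P.cells := P.countable.to_subtype
  obtain ⟨e, he⟩ := exists_injective_nat P.cells
  choose c hc _ using fun s => P.isPartition.2 s
  refine ⟨fun s => e ⟨c s, (hc s).1⟩, ?_, fun s t hst => ?_⟩
  · refine measurable_to_countable fun t => ?_
    convert P.measurableSet _ (hc t).1 using 1
    ext s
    simp only [mem_preimage, mem_singleton_iff, he.eq_iff, Subtype.mk.injEq]
    constructor
    · intro h
      exact h ▸ (hc s).2
    · intro h
      exact (P.isPartition.2 s).unique (hc s) ⟨(hc t).1, h⟩
  · have := congrArg Subtype.val (he hst)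
    simp only at this
    exact ⟨c s, (hc s).1, (hc s).2, this ▸ (hc t).2⟩

theorem IsSamplingRetraction.finer {w : Ω → ℝ≥0∞} {ρ : Ω → Ω}
    (h : IsSamplingRetraction μ univ w ρ) {P : CountablePartition Ω}
    (hP : ∀ s, ∃ E ∈ P.cells, ρ s ∈ E ∧ s ∈ E) : h.partition.Finer P := by
  rintro - ⟨-, ⟨s, rfl⟩, rfl⟩
  obtain ⟨E, hE, hsE, -⟩ := hP s
  refine ⟨E, hE, fun t ht => ?_⟩
  obtain ⟨E', hE', hs', ht'⟩ := hP t
  rw [show ρ t = ρ s from ht] at hs'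
  rwa [(P.isPartition.2 (ρ s)).unique ⟨hE, hsE⟩ ⟨hE', hs'⟩]

end IntegralSum

/-! ### Sets of full outer measure -/

section Full

variable {Ω : Type*} [MeasurableSpace Ω] {μ : Measure Ω}

/-- `E` meets every measurable set of positive measure, i.e. has full outer measure. -/
def IsFull (μ : Measure Ω) (E : Set Ω) : Prop :=
  ∀ D, MeasurableSet D → μ D ≠ 0 → (E ∩ D).Nonempty

theorem IsFull.diff {E G : Set Ω} (hE : IsFull μ E) (hG : MeasurableSet G) (hG0 : μ G = 0) :
    IsFull μ (E \ G) := by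
  intro D hD hD0
  obtain ⟨t, htE, htD, htG⟩ := hE (D \ G) (hD.diff hG) (by rwa [measure_sdiff_null hG0])
  exact ⟨t, ⟨htE, htG⟩, htD⟩

/-- A full set covered by countably many sets contains a full set on which the index of a covering
set can be chosen measurably. -/
theorem IsFull.exists_measurable_index [IsFiniteMeasure μ] {E : Set Ω} (hE : IsFull μ E)
    (A : ℕ → Set Ω) (hA : E ⊆ ⋃ n, A n) :
    ∃ E' ⊆ E, IsFull μ E' ∧ ∃ N : Ω → ℕ, Measurable N ∧ ∀ t ∈ E', t ∈ A (N t) := by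
  classical
  let H : ℕ → Set Ω := fun n => toMeasurable μ (A n ∩ E)
  have hH : ∀ n, MeasurableSet (H n) := fun n => measurableSet_toMeasurable _ _
  have hsub : ∀ n, A n ∩ E ⊆ H n := fun n => subset_toMeasurable _ _
  let U : Set Ω := ⋃ n, H n
  have hU : MeasurableSet U := MeasurableSet.iUnion hH
  have hU0 : μ Uᶜ = 0 := by
    by_contra h0
    obtain ⟨t, htE, htU⟩ := hE _ hU.compl h0
    obtain ⟨n, hn⟩ := mem_iUnion.1 (hA htE)
    exact htU (mem_iUnion.2 ⟨n, hsub n ⟨hn, htE⟩⟩)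
  -- The null complement of `U` is added so that `Nat.find` is defined everywhere.
  let H' : ℕ → Set Ω := fun n => H n ∪ Uᶜ
  have hex : ∀ t, ∃ n, t ∈ H' n := fun t => by
    by_cases ht : t ∈ U
    · obtain ⟨n, hn⟩ := mem_iUnion.1 ht
      exact ⟨n, Or.inl hn⟩
    · exact ⟨0, Or.inr ht⟩
  let N : Ω → ℕ := fun t => Nat.find (hex t)
  have hN : Measurable N := measurable_find hex fun n => (hH n).union hU.compl
  refine ⟨{t ∈ E | t ∈ A (N t)}, fun t ht => ht.1, fun D hD hD0 => ?_, N, hN, fun t ht => ht.2⟩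
  have hDU : D ∩ U = ⋃ n, D ∩ U ∩ N ⁻¹' {n} := by
    ext t
    simp
  have hpos : ∃ n, μ (D ∩ U ∩ N ⁻¹' {n}) ≠ 0 := by
    by_contra! h
    have h1 : μ (D ∩ U) = 0 := by
      rw [hDU]
      exact measure_iUnion_null h
    have h2 : μ D ≤ μ (D ∩ U) + μ Uᶜ := by
      refine (measure_mono fun t ht => ?_).trans (measure_union_le _ _)
      by_cases hu : t ∈ U
      exacts [Or.inl ⟨ht, hu⟩, Or.inr hu]
    exact hD0 (le_antisymm (by simpa [h1, hU0] using h2) zero_le)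
  obtain ⟨n, hn⟩ := hpos
  have hm : MeasurableSet (D ∩ U ∩ N ⁻¹' {n}) := (hD.inter hU).inter (hN (measurableSet_singleton n))
  have hsubH : D ∩ U ∩ N ⁻¹' {n} ⊆ H n := by
    rintro t ⟨⟨-, htU⟩, htn⟩
    have h1 : t ∈ H' (N t) := Nat.find_spec (hex t)
    rw [show N t = n from htn] at h1
    exact h1.resolve_right fun h => h htU
  -- A measurable hull meets a measurable set in the same measure as the original set does, so the
  -- piece contains a point of `A n ∩ E`.
  have h3 := Measure.measure_toMeasurable_inter (μ := μ) (t := A n ∩ E) hm (measure_ne_top _ _)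
  rw [inter_eq_self_of_subset_right hsubH] at h3
  obtain ⟨t, ⟨htA, htE⟩, ⟨htD, -⟩, htn⟩ := nonempty_of_measure_ne_zero (h3 ▸ hn)
  refine ⟨t, ⟨htE, ?_⟩, htD⟩
  rwa [show N t = n from htn]

/-- There are a full set of admissible sampling points and a partition all of whose cells are
good. -/
theorem exists_isFull_isGoodCell [IsFiniteMeasure μ] (hμ : AtomsChargePoints μ) :
    ∃ (E : Set Ω) (π : Ω → ℕ), Measurable π ∧ IsSeparatedSet E ∧ IsFull μ E ∧
      ∀ n, IsGoodCell μ E (π ⁻¹' {n}) := by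
  classical
  -- Points that no measurable set distinguishes are identified, and `r` selects one representative
  -- of each class; `s` and `r s` lie in the same measurable sets.
  let S : Setoid Ω :=
    { r := fun s t => ∀ M, MeasurableSet M → (s ∈ M ↔ t ∈ M)
      iseqv := ⟨fun _ _ _ => Iff.rfl, fun h M hM => (h M hM).symm,
        fun h h' M hM => (h M hM).trans (h' M hM)⟩ }
  let r : Ω → Ω := fun s => (Quotient.mk S s).out
  have hr : ∀ s M, MeasurableSet M → (r s ∈ M ↔ s ∈ M) := fun s M hM =>
    (Quotient.exact (Quotient.out_eq (Quotient.mk S s)) : S.r (r s) s) M hM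
  have hrr : ∀ s t, S.r s t → r s = r t := fun s t h => congrArg Quotient.out (Quotient.sound h)
  have hsep : IsSeparatedSet (range r) := by
    rintro - ⟨s, rfl⟩ - ⟨t, rfl⟩ hst
    by_contra! hcon
    have h1 : ∀ M, MeasurableSet M → r s ∈ M → r t ∈ M := hcon
    refine hst (hrr s t fun M hM => ?_)
    rw [← hr s M hM, ← hr t M hM]
    exact ⟨h1 M hM, fun h => by_contra fun h' => h1 Mᶜ hM.compl h' h⟩
  let Q : Set Ω := {t ∈ range r | μ {t} ≠ 0}
  -- Measurable hulls of separated points are almost disjoint, and a finite measure allows only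
  -- countably many of positive measure.
  have hQc : Q.Countable := by
    have h1 := Measure.countable_meas_pos_of_disjoint_iUnion₀ (μ := μ)
      (As := fun t : range r => toMeasurable μ {(t : Ω)})
      (fun t => (measurableSet_toMeasurable _ _).nullMeasurableSet) (by
        intro s t hst
        obtain ⟨M, hM, hs, ht⟩ := hsep s s.2 t t.2 (Subtype.coe_ne_coe.2 hst)
        have h1 : μ (toMeasurable μ {(s : Ω)} ∩ Mᶜ) = 0 := by
          rw [Measure.measure_toMeasurable_inter hM.compl (measure_ne_top _ _),
            singleton_inter_eq_empty.2 (fun h : (s : Ω) ∈ Mᶜ => h hs), measure_empty]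
        have h2 : μ (toMeasurable μ {(t : Ω)} ∩ M) = 0 := by
          rw [Measure.measure_toMeasurable_inter hM (measure_ne_top _ _),
            singleton_inter_eq_empty.2 ht, measure_empty]
        refine measure_mono_null (fun x hx => ?_) (measure_union_null h1 h2)
        by_cases hxM : x ∈ M
        exacts [Or.inr ⟨hx.2, hxM⟩, Or.inl ⟨hx.1, hxM⟩])
    refine (h1.image Subtype.val).mono ?_
    rintro t ⟨ht, ht0⟩
    refine ⟨⟨t, ht⟩, ?_, rfl⟩
    simpa [measure_toMeasurable, pos_iff_ne_zero] using ht0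
  obtain ⟨N, hNmem, hNm, hNd⟩ :=
    (hsep.mono (sep_subset _ _ : Q ⊆ range r)).exists_disjoint hQc
  let H : Ω → Set Ω := fun t => toMeasurable μ {t} ∩ N t
  have hHm : ∀ t, MeasurableSet (H t) := fun t => (measurableSet_toMeasurable _ _).inter (hNm t)
  have hHmem : ∀ t ∈ Q, t ∈ H t := fun t ht => ⟨subset_toMeasurable μ {t} rfl, hNmem t ht⟩
  have hHd : ∀ s ∈ Q, ∀ t ∈ Q, ∀ x ∈ H s, x ∈ H t → s = t := fun s hs t ht x hxs hxt => by
    by_contra hst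
    exact Set.disjoint_left.1 (hNd hs ht hst) hxs.2 hxt.2
  have : Countable Q := hQc.to_subtype
  obtain ⟨e, he⟩ := exists_injective_nat Q
  let π : Ω → ℕ := fun s => if h : ∃ q : Q, s ∈ H q then e h.choose + 1 else 0
  have hπH : ∀ q : Q, ∀ s ∈ H q, π s = e q + 1 := fun q s hs => by
    have h : ∃ q : Q, s ∈ H q := ⟨q, hs⟩
    have h1 : h.choose = q := Subtype.ext (hHd _ h.choose.2 _ q.2 s h.choose_spec hs)
    simp only [π, dif_pos h, h1]
  have hπ0 : ∀ s, (∀ q : Q, s ∉ H q) → π s = 0 := fun s hs =>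
    dif_neg fun ⟨q, hq⟩ => hs q hq
  have hfib0 : π ⁻¹' {0} = (⋃ q : Q, H q)ᶜ := by
    ext s
    simp only [mem_preimage, mem_singleton_iff, mem_compl_iff, mem_iUnion, not_exists]
    refine ⟨fun h q hq => ?_, hπ0 s⟩
    rw [hπH q s hq] at h
    exact absurd h (Nat.succ_ne_zero _)
  have hfib1 : ∀ n, π ⁻¹' {n + 1} = ⋃ (q : Q) (_ : e q = n), H q := fun n => by
    ext s
    simp only [mem_preimage, mem_singleton_iff, mem_iUnion, exists_prop]
    constructor
    · intro h
      by_contra! hcon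
      by_cases hq : ∃ q : Q, s ∈ H q
      · obtain ⟨q, hq⟩ := hq
        rw [hπH q s hq] at h
        exact hcon q (Nat.succ_injective h) hq
      · rw [hπ0 s fun q h' => hq ⟨q, h'⟩] at h
        exact absurd h.symm (Nat.succ_ne_zero _)
    · rintro ⟨q, hq, hs⟩
      rw [hπH q s hs, hq]
  have hπm : Measurable π := by
    refine measurable_to_countable' fun n => ?_
    cases n with
    | zero => rw [hfib0]; exact (MeasurableSet.iUnion fun q : Q => hHm q).compl
    | succ n => rw [hfib1]; exact MeasurableSet.iUnion fun q : Q => MeasurableSet.iUnion fun _ => hHm q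
  -- Within `H q` only `q` is kept. Fullness survives: a measurable set meeting `H q` in positive
  -- measure contains `q`, and one meeting every `H q` in a null set contains a representative
  -- outside all of them.
  refine ⟨{t ∈ range r | ∀ q ∈ Q, t ∈ H q → t = q}, π, hπm, hsep.mono (sep_subset _ _), ?_, ?_⟩
  · intro D hD hD0
    by_cases h : ∃ q ∈ Q, μ (H q ∩ D) ≠ 0
    · obtain ⟨q, hq, hqD⟩ := h
      refine ⟨q, ⟨hq.1, fun q' hq' h' => hHd q hq q' hq' q (hHmem q hq) h'⟩, ?_⟩
      by_contra hn
      refine hqD (measure_mono_null (inter_subset_inter_left _ inter_subset_left) ?_)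
      rw [Measure.measure_toMeasurable_inter hD (measure_ne_top _ _), singleton_inter_eq_empty.2 hn,
        measure_empty]
    · push Not at h
      have h0 : μ (⋃ q ∈ Q, H q ∩ D) = 0 := (measure_biUnion_null_iff hQc).2 h
      have hm : MeasurableSet (⋃ q ∈ Q, H q ∩ D) :=
        MeasurableSet.biUnion hQc fun q _ => (hHm q).inter hD
      obtain ⟨s, hs⟩ := nonempty_of_measure_ne_zero
        (show μ (D \ ⋃ q ∈ Q, H q ∩ D) ≠ 0 by rwa [measure_sdiff_null h0])
      have hs' := (hr s _ (hD.diff hm)).2 hs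
      refine ⟨r s, ⟨⟨s, rfl⟩, fun q hq hqs => absurd ?_ hs'.2⟩, hs'.1⟩
      exact mem_iUnion₂.2 ⟨q, hq, hqs, hs'.1⟩
  · intro n
    cases n with
    | zero =>
      rw [hfib0]
      refine Or.inl ⟨fun A hA hatom => ?_, fun t ht => ?_⟩
      -- An atom `A` has a point `t` of positive outer measure. Then `r t` is in `A` as well and has
      -- positive outer measure, so `A` meets `H (r t)`.
      · obtain ⟨t, htA, ht0⟩ := hμ A hatom
        have hrQ : r t ∈ Q := by
          refine ⟨⟨t, rfl⟩, fun h0 => ht0 ?_⟩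
          refine measure_mono_null ?_ ((measure_toMeasurable (μ := μ) {r t}).trans h0)
          exact singleton_subset_iff.2 ((hr t _ (measurableSet_toMeasurable _ _)).1
            (subset_toMeasurable μ {r t} rfl))
        exact hA ((hr t A hatom.1).2 htA) (mem_iUnion.2 ⟨⟨r t, hrQ⟩, hHmem _ hrQ⟩)
      · by_contra h0
        have htQ : t ∈ Q := ⟨ht.1.1, h0⟩
        exact ht.2 (mem_iUnion.2 ⟨⟨t, htQ⟩, hHmem t htQ⟩)
    | succ n =>
      refine Or.inr ?_
      rw [hfib1]
      rintro s ⟨hsE, hs⟩ t ⟨htE, ht⟩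
      obtain ⟨q, hq, hs⟩ := mem_iUnion₂.1 hs
      obtain ⟨q', hq', ht⟩ := mem_iUnion₂.1 ht
      have : q = q' := he (Eq.trans hq hq'.symm)
      rw [hsE.2 q q.2 hs, htE.2 q' q'.2 ht, this]

end Full

/-! ### Admissible weights -/

section Weights

variable {Ω : Type*} [MeasurableSpace Ω] {μ : Measure Ω}
  {X : Type*} [NormedAddCommGroup X] [NormedSpace ℝ X]

/-- Weights on points of `E` whose sums over the fibres of `π` agree with `μ`. -/
def sampleWeights (μ : Measure Ω) (E : Set Ω) (π : Ω → ℕ) : Set (Ω → ℝ≥0) :=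
  {w | (∀ t ∉ E, w t = 0) ∧
    ∀ H : ℕ → ℝ≥0∞, ∑' t, (w t : ℝ≥0∞) * H (π t) = ∫⁻ t, H (π t) ∂μ}

/-- Because the weights are tested against every `H`, not only indicators of fibres, it suffices to
replace `H` by `H ∘ h`. This is what makes the sets of weights directed. -/
theorem sampleWeights_mono {E E' : Set Ω} (hE : E ⊆ E') {π π' : Ω → ℕ} (h : ℕ → ℕ)
    (hπ : ∀ t, π' t = h (π t)) : sampleWeights μ E π ⊆ sampleWeights μ E' π' := by
  rintro w ⟨h1, h2⟩
  refine ⟨fun t ht => h1 t fun h' => ht (hE h'), fun H => ?_⟩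
  simp only [hπ]
  exact h2 (H ∘ h)

theorem lintegral_comp_nat {π : Ω → ℕ} (hπ : Measurable π) (H : ℕ → ℝ≥0∞) :
    ∫⁻ t, H (π t) ∂μ = ∑' n, H n * μ (π ⁻¹' {n}) := by
  rw [← lintegral_map (measurable_from_nat (f := H)) hπ, lintegral_countable']
  refine tsum_congr fun n => ?_
  rw [Measure.map_apply hπ (measurableSet_singleton n)]

/-- Fullness provides a point of `E` in every non-null fibre; it receives the whole mass of the
fibre. -/
theorem sampleWeights_nonempty [IsFiniteMeasure μ] {E : Set Ω} (hE : IsFull μ E) {π : Ω → ℕ}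
    (hπ : Measurable π) : (sampleWeights μ E π).Nonempty := by
  classical
  rcases isEmpty_or_nonempty Ω with hΩ | hΩ
  · exact ⟨0, fun t _ => rfl, fun H => by simp⟩
  have : ∀ n, ∃ t, μ (π ⁻¹' {n}) ≠ 0 → t ∈ E ∧ π t = n := fun n => by
    by_cases h : μ (π ⁻¹' {n}) = 0
    · exact ⟨Classical.arbitrary Ω, fun h' => absurd h h'⟩
    · obtain ⟨t, ht⟩ := hE _ (hπ (measurableSet_singleton n)) h
      exact ⟨t, fun _ => ht⟩
  choose t ht using this
  let m : ℕ → ℝ≥0 := fun n => (μ (π ⁻¹' {n})).toNNReal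
  have hm : ∀ n, (m n : ℝ≥0∞) = μ (π ⁻¹' {n}) := fun n => ENNReal.coe_toNNReal (measure_ne_top _ _)
  have hm0 : ∀ n, m n ≠ 0 → t n ∈ E ∧ π (t n) = n := fun n h => ht n (by
    rw [← hm]; exact_mod_cast h)
  refine ⟨fun s => if s = t (π s) then m (π s) else 0, fun s hs => ?_, fun H => ?_⟩
  · dsimp only
    split_ifs with h
    · by_contra h0
      exact hs (h ▸ (hm0 _ h0).1)
    · rfl
  -- For a null fibre `t n` is arbitrary and may lie in another fibre, but then `m n = 0`.
  · have h1 : ∀ s, ((if s = t (π s) then m (π s) else 0 : ℝ≥0) : ℝ≥0∞) * H (π s) =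
        ∑' n, if s = t n then (m n : ℝ≥0∞) * H n else 0 := fun s => by
      rw [tsum_eq_single (π s)]
      · split_ifs <;> simp
      · intro n hn
        split_ifs with h
        · have : m n = 0 := by
            by_contra h0
            exact hn (by rw [h, (hm0 n h0).2])
          simp [this]
        · rfl
    simp only [h1]
    rw [ENNReal.tsum_comm, lintegral_comp_nat hπ]
    refine tsum_congr fun n => ?_
    rw [tsum_ite_eq, hm, mul_comm]

theorem tsum_sampleWeights {E : Set Ω} {π : Ω → ℕ} {w : Ω → ℝ≥0} (hw : w ∈ sampleWeights μ E π) :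
    ∑' t, (w t : ℝ≥0∞) = μ univ := by
  simpa using hw.2 fun _ => 1

/-- Admissible weights for a partition with good cells come from integral sums. -/
theorem exists_sampling_of_mem_sampleWeights [IsFiniteMeasure μ] {E : Set Ω}
    (hE : IsSeparatedSet E) {π : Ω → ℕ} (hπ : Measurable π)
    (hgood : ∀ n, IsGoodCell μ E (π ⁻¹' {n})) {P : CountablePartition Ω}
    (hP : ∀ s t, π s = π t → ∃ A ∈ P.cells, s ∈ A ∧ t ∈ A) {w : Ω → ℝ≥0}
    (hw : w ∈ sampleWeights μ E π) {f : Ω → X} (hs : Summable fun t => ‖(w t : ℝ) • f t‖) {x : X}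
    (hx : HasSum (fun t => (w t : ℝ) • f t) x) :
    ∃ Γ : CountablePartition Ω, Γ.Finer P ∧ ∃ T : Γ.cells → Ω, IsSampling Γ T ∧
      IsAbsoluteSum μ f Γ T ∧ integralSum μ f Γ T = x := by
  classical
  have hex : ∀ n, ∃ ρ, IsSamplingRetraction μ (π ⁻¹' {n}) (fun t => (w t : ℝ≥0∞)) ρ := fun n => by
    refine exists_isSamplingRetraction (hπ (measurableSet_singleton n)) hE (hgood n)
      (fun t ht => by simp [hw.1 t ht]) ?_
    have h1 := hw.2 (Pi.single n 1)
    have h2 : ∫⁻ t, (Pi.single n 1 : ℕ → ℝ≥0∞) (π t) ∂μ = μ (π ⁻¹' {n}) := by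
      rw [← lintegral_indicator_one (hπ (measurableSet_singleton n))]
      refine lintegral_congr fun t => ?_
      by_cases h : π t = n <;> simp [indicator, h]
    rw [← h2, ← h1]
    refine tsum_congr fun t => ?_
    by_cases h : π t = n <;> simp [indicator, h]
  obtain ⟨ρ, hρ, hρπ⟩ := exists_isSamplingRetraction_univ hex
  exact ⟨hρ.partition, hρ.finer fun s => hP _ _ (hρπ s), hρ.exists_sampling hs hx⟩

/-- The sums `∑ w t • f t` over admissible weights form a convex set. -/
theorem convex_sampleSums (μ : Measure Ω) (E : Set Ω) (π : Ω → ℕ) (f : Ω → X) :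
    Convex ℝ {x | ∃ w ∈ sampleWeights μ E π, HasSum (fun t => (w t : ℝ) • f t) x} := by
  rintro x ⟨w, hw, hx⟩ y ⟨v, hv, hy⟩ a b ha hb hab
  lift a to ℝ≥0 using ha
  lift b to ℝ≥0 using hb
  refine ⟨fun t => a * w t + b * v t, ⟨fun t ht => ?_, fun H => ?_⟩, ?_⟩
  · simp [hw.1 t ht, hv.1 t ht]
  · have hab' : (a : ℝ≥0∞) + b = 1 := by exact_mod_cast hab
    simp only [ENNReal.coe_add, ENNReal.coe_mul, add_mul, mul_assoc]
    rw [ENNReal.tsum_add, ENNReal.tsum_mul_left, ENNReal.tsum_mul_left, hw.2, hv.2, ← add_mul,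
      hab', one_mul]
  · convert (hx.const_smul (a : ℝ)).add (hy.const_smul (b : ℝ)) using 2
    simp [add_smul, mul_smul]

end Weights

/-! ### Absorbing convex hulls in weakly compactly generated spaces -/

section Generation

variable {X : Type*} [NormedAddCommGroup X] [NormedSpace ℝ X]

theorem isCompact_toWeakSpace_smul {L : Set X} (hL : IsCompact (toWeakSpace ℝ X '' L)) (R : ℝ) :
    IsCompact (toWeakSpace ℝ X '' (R • L)) := by
  rw [image_smul_set]
  exact hL.smul R

/-- In a weakly compactly generated space there is a weakly compact set whose convex hull is
balanced and has multiples that come arbitrarily close to every point. -/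
theorem IsWCG.exists_balanced (hX : IsWCG X) :
    ∃ L : Set X, IsCompact (toWeakSpace ℝ X '' L) ∧ Balanced ℝ (convexHull ℝ L) ∧
      (convexHull ℝ L).Nonempty ∧
      ∀ x, ∀ ε > 0, ∃ n : ℕ, ∃ c ∈ convexHull ℝ L, ‖x - (n : ℝ) • c‖ ≤ ε := by
  obtain ⟨K, hK, hd⟩ := hX
  -- Multiplication by [-1, 1] makes the set balanced and keeps it weakly compact; the added 0
  -- covers an empty `K`.
  let L : Set X := Metric.closedBall (0 : ℝ) 1 • insert 0 K
  have hLc : IsCompact (toWeakSpace ℝ X '' L) := by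
    have h1 : IsCompact (toWeakSpace ℝ X '' insert 0 K) := by
      rw [image_insert_eq]
      exact hK.insert _
    have h2 : toWeakSpace ℝ X '' L =
        Metric.closedBall (0 : ℝ) 1 • (toWeakSpace ℝ X '' insert 0 K) := by
      ext z
      simp only [L, mem_image, Set.mem_smul]
      constructor
      · rintro ⟨-, ⟨r, hr, y, hy, rfl⟩, rfl⟩
        exact ⟨r, hr, _, ⟨y, hy, rfl⟩, (map_smul _ _ _).symm⟩
      · rintro ⟨r, hr, -, ⟨y, hy, rfl⟩, rfl⟩
        exact ⟨_, ⟨r, hr, y, hy, rfl⟩, map_smul _ _ _⟩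
    rw [h2]
    exact (isCompact_closedBall (0 : ℝ) 1).smul_set h1
  have hLb : Balanced ℝ L := by
    rw [balanced_iff_smul_mem]
    rintro a ha - ⟨r, hr, y, hy, rfl⟩
    refine ⟨a * r, ?_, y, hy, mul_smul a r y⟩
    rw [mem_closedBall_zero_iff] at hr ⊢
    rw [norm_mul]
    exact mul_le_one₀ ha (norm_nonneg _) hr
  have hCb : Balanced ℝ (convexHull ℝ L) := hLb.convexHull
  have h0 : (0 : X) ∈ convexHull ℝ L := subset_convexHull ℝ L
    ⟨0, by simp, 0, mem_insert _ _, by simp⟩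
  have hspan : ∀ x ∈ Submodule.span ℝ K, ∃ n : ℕ, x ∈ (n : ℝ) • convexHull ℝ L := by
    intro x hx
    induction hx using Submodule.span_induction with
    | mem x hx =>
      refine ⟨1, x, subset_convexHull ℝ L ⟨1, by simp, x, mem_insert_of_mem _ hx, one_smul _ _⟩, ?_⟩
      simp
    | zero => exact ⟨0, 0, h0, by simp⟩
    | add x y _ _ hx hy =>
      obtain ⟨n, hn⟩ := hx
      obtain ⟨m, hm⟩ := hy
      refine ⟨n + m, ?_⟩
      rw [Nat.cast_add, (convex_convexHull ℝ L).add_smul n.cast_nonneg m.cast_nonneg]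
      exact add_mem_add hn hm
    | smul a x _ hx =>
      obtain ⟨n, hn⟩ := hx
      refine ⟨⌈|a * n|⌉₊, ?_⟩
      have h1 : (a * n) • convexHull ℝ L ⊆ ((⌈|a * n|⌉₊ : ℕ) : ℝ) • convexHull ℝ L := by
        refine hCb.smul_mono ?_
        rw [Real.norm_eq_abs, Real.norm_eq_abs, Nat.abs_cast]
        exact Nat.le_ceil _
      refine h1 ?_
      rw [mul_smul]
      exact smul_mem_smul_set hn
  refine ⟨L, hLc, hCb, ⟨0, h0⟩, fun x ε hε => ?_⟩
  obtain ⟨y, hy, hxy⟩ := Metric.mem_closure_iff.1 (hd x) ε hε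
  obtain ⟨n, c, hc, hcy⟩ := hspan y hy
  refine ⟨n, c, hc, ?_⟩
  have hcy' : (n : ℝ) • c = y := hcy
  rw [hcy', ← dist_eq_norm]
  exact hxy.le

/-- The sum is `∑ α` times a centre of mass of points of `C`, and 0 ∈ C allows the factor to grow to
`R`. -/
theorem sum_smul_mem_smul {ι : Type*} {C : Set X} (hC : Convex ℝ C) (h0 : (0 : X) ∈ C)
    (Q : Finset ι) (α : ι → ℝ) (hα : ∀ i ∈ Q, 0 ≤ α i) (c : ι → X) (hc : ∀ i ∈ Q, c i ∈ C) {R : ℝ}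
    (hR : ∑ i ∈ Q, α i ≤ R) : ∑ i ∈ Q, α i • c i ∈ R • C := by
  rcases (Finset.sum_nonneg hα).eq_or_lt with h | h
  · have hz := (Finset.sum_eq_zero_iff_of_nonneg hα).1 h.symm
    rw [Finset.sum_eq_zero fun i hi => by rw [hz i hi, zero_smul]]
    exact ⟨0, h0, smul_zero R⟩
  · have hm := hC.centerMass_mem hα h hc
    have hR0 : 0 < R := h.trans_le hR
    refine ⟨(R⁻¹ * ∑ i ∈ Q, α i) • Q.centerMass α c,
      hC.smul_mem_of_zero_mem h0 hm ⟨by positivity, ?_⟩, ?_⟩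
    · rw [inv_mul_le_iff₀ hR0, mul_one]
      exact hR
    · change R • ((R⁻¹ * ∑ i ∈ Q, α i) • Q.centerMass α c) = _
      rw [smul_smul, ← mul_assoc, mul_inv_cancel₀ hR0.ne', one_mul, Finset.centerMass, smul_smul,
        mul_inv_cancel₀ h.ne', one_smul]

end Generation

/-! ### Weak convergence of the sums and the limit set -/

section LimitSet

variable {Ω : Type*} [MeasurableSpace Ω] {μ : Measure Ω}
  {X : Type*} [NormedAddCommGroup X] [NormedSpace ℝ X]

/-- A function of the upper `L₁` space is dominated off a null set by an integrable measurable
function with values in `ℕ`. -/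
theorem exists_nat_dominating [IsFiniteMeasure μ] {X : Type*} [NormedAddCommGroup X] {f : Ω → X} (hf : f ∈ upperL1 μ X) :
    ∃ (N : Ω → ℕ) (G : Set Ω), Measurable N ∧ ∫⁻ t, (N t : ℝ≥0∞) ∂μ ≠ ∞ ∧ MeasurableSet G ∧
      μ G = 0 ∧ ∀ t ∉ G, ‖f t‖ ≤ N t := by
  have hf' : upperIntegral μ (fun t => ‖f t‖₊) < ∞ := hf
  simp only [upperIntegral, iInf_lt_iff] at hf'
  obtain ⟨g, hg, hfg, -⟩ := hf'
  -- `g` is only a.e. measurable: it is replaced by a measurable version, and a measurable null set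
  -- containing the points of disagreement becomes `G`.
  let g' := hg.1.mk g
  have hg' : Measurable g' := hg.1.stronglyMeasurable_mk.measurable
  have hgi : Integrable g' μ := hg.congr hg.1.ae_eq_mk
  refine ⟨fun t => ⌈g' t⌉₊, toMeasurable μ {t | ¬ g t = g' t}, hg'.nat_ceil, ?_,
    measurableSet_toMeasurable _ _, ?_, fun t ht => ?_⟩
  · have h1 : ∫⁻ t, (‖g' t‖ₑ + 1) ∂μ < ∞ := by
      rw [lintegral_add_right _ measurable_const, lintegral_one]
      exact ENNReal.add_lt_top.2 ⟨hgi.2, measure_lt_top _ _⟩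
    refine (lt_of_le_of_lt (lintegral_mono fun t => ?_) h1).ne
    have h2 : ((⌈g' t⌉₊ : ℕ) : ℝ) ≤ ‖g' t‖ + 1 := by
      rcases le_total 0 (g' t) with h | h
      · exact (Nat.ceil_lt_add_one h).le.trans (by rw [Real.norm_of_nonneg h])
      · rw [Nat.ceil_eq_zero.2 h, Nat.cast_zero]
        positivity
    calc ((⌈g' t⌉₊ : ℕ) : ℝ≥0∞) = ENNReal.ofReal ((⌈g' t⌉₊ : ℕ) : ℝ) :=
          (ENNReal.ofReal_natCast _).symm
      _ ≤ ENNReal.ofReal (‖g' t‖ + 1) := ENNReal.ofReal_le_ofReal h2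
      _ = ‖g' t‖ₑ + 1 := by
          rw [ENNReal.ofReal_add (norm_nonneg _) zero_le_one, ofReal_norm, ENNReal.ofReal_one]
  · rw [measure_toMeasurable]
    exact ae_iff.1 hg.1.ae_eq_mk
  · have h1 : g t = g' t := by
      by_contra h
      exact ht (subset_toMeasurable _ _ h)
    have h2 := hfg t
    rw [h1] at h2
    exact h2.trans (Nat.le_ceil _)

/-- Testing the weights against `H n = n` bounds the series of norms by the integral of `N`. -/
theorem summable_of_mem_sampleWeights {E : Set Ω} {f : Ω → X} {N : Ω → ℕ}
    (hN : ∫⁻ t, (N t : ℝ≥0∞) ∂μ ≠ ∞) (hfN : ∀ t ∈ E, ‖f t‖ ≤ N t) {w : Ω → ℝ≥0}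
    (hw : w ∈ sampleWeights μ E N) : Summable fun t => ‖(w t : ℝ) • f t‖ := by
  have h1 : ∑' t, (w t : ℝ≥0∞) * (N t : ℝ≥0∞) ≠ ∞ := by
    rwa [hw.2 fun n => (n : ℝ≥0∞)]
  refine Summable.of_nonneg_of_le (fun _ => norm_nonneg _) (fun t => ?_)
    (ENNReal.summable_toReal h1)
  simp only [norm_smul, NNReal.norm_eq, ENNReal.toReal_mul, ENNReal.coe_toReal,
    ENNReal.toReal_natCast]
  by_cases ht : t ∈ E
  · gcongr
    exact hfN t ht
  · simp [hw.1 t ht]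

theorem tendsto_lintegral_tail {N M : Ω → ℕ} (hN : Measurable N) (hM : Measurable M)
    (hNi : ∫⁻ t, (N t : ℝ≥0∞) ∂μ ≠ ∞) :
    Tendsto (fun m : ℕ => ∫⁻ t, (if m < M t then (N t : ℝ≥0∞) else 0) ∂μ) atTop (𝓝 0) := by
  have hNe : Measurable fun t => (N t : ℝ≥0∞) := measurable_from_nat.comp hN
  have := tendsto_lintegral_of_dominated_convergence (μ := μ)
    (F := fun (m : ℕ) t => if m < M t then (N t : ℝ≥0∞) else 0) (f := fun _ => 0)
    (fun t => (N t : ℝ≥0∞))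
    (fun m => Measurable.ite (measurableSet_lt measurable_const hM) hNe measurable_const)
    (fun m => Eventually.of_forall fun t => by dsimp only; split_ifs <;> simp) hNi
    (Eventually.of_forall fun t => by
      refine tendsto_const_nhds.congr' ?_
      filter_upwards [eventually_ge_atTop (M t)] with m hm
      rw [if_neg (not_lt.2 hm)])
  simpa using this

/-- If `f` is, up to `δ`, a bounded multiple of elements of a convex set `C` at all admissible
points with index `M t ≤ m`, then so are the sums over admissible weights, up to the mass of
the remaining points. -/
theorem exists_norm_tsum_sub_le [IsFiniteMeasure μ] {C : Set X} {E : Set Ω} {f : Ω → X}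
    (hC : Convex ℝ C) (h0 : (0 : X) ∈ C) {N M π : Ω → ℕ}
    (hfN : ∀ t ∈ E, ‖f t‖ ≤ N t) {δ ε : ℝ} (hδ : 0 ≤ δ) (hε : 0 < ε)
    (hfM : ∀ t ∈ E, ∃ c ∈ C, ‖f t - (M t : ℝ) • c‖ ≤ δ) {m : ℕ}
    (hm : ∫⁻ t, (if m < M t then (N t : ℝ≥0∞) else 0) ∂μ ≤ ENNReal.ofReal ε)
    (hπ : ∀ t, π t = Nat.pair (N t) (M t)) {w : Ω → ℝ≥0} (hw : w ∈ sampleWeights μ E π)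
    {x : X} (hx : HasSum (fun t => (w t : ℝ) • f t) x) :
    ∃ a ∈ (μ.real univ * m) • C, ‖x - a‖ ≤ ε + ε + μ.real univ * δ := by
  classical
  -- Passing to a finite partial sum costs one `ε`, dropping the points with `m < M t` costs the
  -- other, and replacing `f t` by `M t • c t` costs the total mass times `δ`.
  obtain ⟨Q, hQ⟩ := (Metric.tendsto_nhds.1 hx ε hε).exists
  choose! c hcC hc using hfM
  have hwE : ∀ t, t ∉ E → (w t : ℝ) = 0 := fun t ht => by rw [hw.1 t ht]; rfl
  have hsum : ∑ t ∈ Q, (w t : ℝ) ≤ μ.real univ := by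
    have h1 : (∑ t ∈ Q, (w t : ℝ≥0∞)) ≤ μ univ :=
      (ENNReal.sum_le_tsum Q).trans (tsum_sampleWeights hw).le
    have h2 := ENNReal.toReal_mono (measure_ne_top _ _) h1
    rw [ENNReal.toReal_sum fun t _ => ENNReal.coe_ne_top] at h2
    exact h2
  let Q₁ := Q.filter fun t => M t ≤ m ∧ t ∈ E
  let Q₂ := Q.filter fun t => ¬ (M t ≤ m ∧ t ∈ E)
  have hsum1 : ∑ t ∈ Q₁, (w t : ℝ) ≤ μ.real univ :=
    (Finset.sum_le_sum_of_subset_of_nonneg (Finset.filter_subset _ _)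
      fun t _ _ => (w t).coe_nonneg).trans hsum
  have hsplit : ∑ t ∈ Q, (w t : ℝ) • f t =
      ∑ t ∈ Q₁, (w t : ℝ) • f t + ∑ t ∈ Q₂, (w t : ℝ) • f t :=
    (Finset.sum_filter_add_sum_filter_not Q _ _).symm
  have htail : ‖∑ t ∈ Q₂, (w t : ℝ) • f t‖ ≤ ε := by
    -- The truncated `N` depends on both `N` and `M`, which is why `π` has to encode the pair.
    have h1 : ∑' t, (w t : ℝ≥0∞) * (if m < M t then (N t : ℝ≥0∞) else 0) ≤ ENNReal.ofReal ε := by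
      have := hw.2 fun k => if m < k.unpair.2 then (k.unpair.1 : ℝ≥0∞) else 0
      simp only [hπ, Nat.unpair_pair] at this
      rw [this]
      exact hm
    have h2 : ∑ t ∈ Q₂, ‖(w t : ℝ) • f t‖ₑ ≤ ENNReal.ofReal ε := by
      refine (Finset.sum_le_sum fun t ht => ?_).trans ((ENNReal.sum_le_tsum Q₂).trans h1)
      by_cases htE : t ∈ E
      · have hmt : m < M t := by
          by_contra h
          exact (Finset.mem_filter.1 ht).2 ⟨not_lt.1 h, htE⟩
        rw [if_pos hmt, enorm_smul]
        gcongr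
        · simp [enorm_eq_nnnorm]
        · rw [← ofReal_norm, ← ENNReal.ofReal_natCast]
          exact ENNReal.ofReal_le_ofReal (hfN t htE)
      · simp [hw.1 t htE]
    have h3 : ‖∑ t ∈ Q₂, (w t : ℝ) • f t‖ₑ ≤ ENNReal.ofReal ε := (enorm_sum_le _ _).trans h2
    rw [← ofReal_norm] at h3
    exact (ENNReal.ofReal_le_ofReal_iff hε.le).1 h3
  refine ⟨∑ t ∈ Q₁, ((w t : ℝ) * M t) • c t, ?_, ?_⟩
  · refine sum_smul_mem_smul hC h0 Q₁ _ (fun t _ => by positivity) c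
      (fun t ht => hcC t (Finset.mem_filter.1 ht).2.2) ?_
    calc ∑ t ∈ Q₁, (w t : ℝ) * M t ≤ ∑ t ∈ Q₁, (w t : ℝ) * m := by
          refine Finset.sum_le_sum fun t ht => ?_
          gcongr
          exact (Finset.mem_filter.1 ht).2.1
      _ = (∑ t ∈ Q₁, (w t : ℝ)) * m := (Finset.sum_mul _ _ _).symm
      _ ≤ _ := by gcongr
  · have hmain : ‖∑ t ∈ Q₁, (w t : ℝ) • f t - ∑ t ∈ Q₁, ((w t : ℝ) * M t) • c t‖ ≤
        μ.real univ * δ := by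
      rw [← Finset.sum_sub_distrib]
      calc _ ≤ ∑ t ∈ Q₁, (w t : ℝ) * δ := by
            refine norm_sum_le_of_le _ fun t ht => ?_
            rw [mul_smul, ← smul_sub, norm_smul, NNReal.norm_eq]
            gcongr
            exact hc t (Finset.mem_filter.1 ht).2.2
        _ = (∑ t ∈ Q₁, (w t : ℝ)) * δ := (Finset.sum_mul _ _ _).symm
        _ ≤ _ := by gcongr
    have hQ' : ‖x - ∑ t ∈ Q, (w t : ℝ) • f t‖ ≤ ε := by
      rw [← dist_eq_norm, dist_comm]
      exact hQ.le
    set A := ∑ t ∈ Q₁, (w t : ℝ) • f t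
    set B := ∑ t ∈ Q₂, (w t : ℝ) • f t
    set D := ∑ t ∈ Q₁, ((w t : ℝ) * M t) • c t
    have : x - D = (x - ∑ t ∈ Q, (w t : ℝ) • f t) + B + (A - D) := by
      rw [hsplit]
      abel
    rw [this]
    refine (norm_add₃_le).trans ?_
    linarith

/-- A decreasing sequence of full sets on which `f` is close to measurably indexed multiples of
elements of `C`. -/
theorem exists_seq_isFull [IsFiniteMeasure μ] {E₀ : Set Ω} (hE₀ : IsFull μ E₀) {C : Set X}
    (hC : ∀ x, ∀ ε > 0, ∃ n : ℕ, ∃ c ∈ C, ‖x - (n : ℝ) • c‖ ≤ ε) (f : Ω → X) {δ : ℕ → ℝ}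
    (hδ : ∀ k, 0 < δ k) :
    ∃ (E : ℕ → Set Ω) (M : ℕ → Ω → ℕ), E 0 = E₀ ∧ Antitone E ∧ (∀ k, IsFull μ (E k)) ∧
      (∀ k, Measurable (M k)) ∧
      ∀ k, ∀ t ∈ E (k + 1), ∃ c ∈ C, ‖f t - (M k t : ℝ) • c‖ ≤ δ k := by
  have hstep : ∀ (k : ℕ) (E : {E // IsFull μ E}), ∃ E' : {E // IsFull μ E}, E'.1 ⊆ E.1 ∧
      ∃ M : Ω → ℕ, Measurable M ∧ ∀ t ∈ E'.1, ∃ c ∈ C, ‖f t - (M t : ℝ) • c‖ ≤ δ k := by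
    intro k E
    obtain ⟨E', hE', hE'f, M, hM, h⟩ := E.2.exists_measurable_index
      (fun n => {t | ∃ c ∈ C, ‖f t - (n : ℝ) • c‖ ≤ δ k})
      fun t _ => mem_iUnion.2 (hC (f t) (δ k) (hδ k))
    exact ⟨⟨E', hE'f⟩, hE', M, hM, h⟩
  choose F hF M hM hFM using hstep
  -- `M k` is obtained from `E k` but approximates `f` only on the smaller set `E (k + 1)`.
  let E : ℕ → {E // IsFull μ E} := fun k => Nat.rec ⟨E₀, hE₀⟩ (fun k E => F k E) k
  exact ⟨fun k => (E k).1, fun k => M k (E k), rfl, antitone_nat_of_succ_le fun k => hF k (E k),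
    fun k => (E k).2, fun k => hM k (E k), fun k => hFM k (E k)⟩

theorem measurable_natPair {π π' : Ω → ℕ} (hπ : Measurable π) (hπ' : Measurable π') :
    Measurable fun t => Nat.pair (π t) (π' t) :=
  (measurable_from_prod_countable_right (f := fun p : ℕ × ℕ => Nat.pair p.1 p.2)
    fun _ => measurable_from_nat).comp (hπ.prodMk hπ')

/-- There is an ultrafilter on the weights that contains all the sets of admissible weights. -/
theorem exists_ultrafilter_sampleWeights [IsFiniteMeasure μ] {E : ℕ → Set Ω} (hE : Antitone E)
    (hEf : ∀ k, IsFull μ (E k)) :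
    ∃ F : Ultrafilter (Ω → ℝ≥0), ∀ k, ∀ π : Ω → ℕ, Measurable π →
      sampleWeights μ (E k) π ∈ (F : Filter (Ω → ℝ≥0)) := by
  let I := ℕ × {π : Ω → ℕ // Measurable π}
  let B : I → Filter (Ω → ℝ≥0) := fun i => 𝓟 (sampleWeights μ (E i.1) i.2)
  have hdir : Directed (· ≥ ·) B := by
    rintro ⟨k, π, hπ⟩ ⟨l, π', hπ'⟩
    refine ⟨⟨max k l, _, measurable_natPair hπ hπ'⟩, ?_, ?_⟩
    · exact principal_mono.2 (sampleWeights_mono (hE (le_max_left k l)) (fun p => p.unpair.1)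
        fun t => by simp)
    · exact principal_mono.2 (sampleWeights_mono (hE (le_max_right k l)) (fun p => p.unpair.2)
        fun t => by simp)
  have : Nonempty I := ⟨(0, ⟨fun _ => 0, measurable_const⟩)⟩
  have : NeBot (⨅ i, B i) := iInf_neBot_of_directed' hdir fun i =>
    principal_neBot_iff.2 (sampleWeights_nonempty (hEf i.1) i.2.2)
  refine ⟨Ultrafilter.of (⨅ i, B i), fun k π hπ => ?_⟩
  exact Ultrafilter.of_le _ (mem_iInf_of_mem (⟨k, π, hπ⟩ : I) (mem_principal_self _))

/-- In a weakly compactly generated space the limit set of every function of the upper `L₁` space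
is nonempty. -/
theorem limitSet_nonempty [IsFiniteMeasure μ] (hμ : AtomsChargePoints μ) [CompleteSpace X]
    (hX : IsWCG X) {f : Ω → X} (hf : f ∈ upperL1 μ X) : (limitSet μ f).Nonempty := by
  obtain ⟨E₀, π₀, hπ₀, hsep, hfull, hgood⟩ := exists_isFull_isGoodCell hμ
  obtain ⟨N, G, hN, hNi, hG, hG0, hfN⟩ := exists_nat_dominating hf
  obtain ⟨L, hL, hLb, hLne, hLd⟩ := hX.exists_balanced
  obtain ⟨E, M, hE0, hEanti, hEf, hM, hEM⟩ := exists_seq_isFull (hfull.diff hG hG0) hLd f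
    (δ := fun k : ℕ => 1 / (k + 1 : ℝ)) fun k => by positivity
  obtain ⟨F, hF⟩ := exists_ultrafilter_sampleWeights hEanti hEf
  have hEsub : ∀ k, E k ⊆ E₀ \ G := fun k => hE0 ▸ hEanti k.zero_le
  have hfN' : ∀ k, ∀ t ∈ E k, ‖f t‖ ≤ N t := fun k t ht => hfN t (hEsub k ht).2
  have h0 : (0 : X) ∈ convexHull ℝ L := hLb.zero_mem hLne
  have hsumm : ∀ w ∈ sampleWeights μ (E 0) N, Summable fun t => ‖(w t : ℝ) • f t‖ := fun w hw =>
    summable_of_mem_sampleWeights hNi (hfN' 0) hw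
  let s : (Ω → ℝ≥0) → X := fun w => ∑' t, (w t : ℝ) • f t
  have hs : ∀ w ∈ sampleWeights μ (E 0) N, HasSum (fun t => (w t : ℝ) • f t) (s w) :=
    fun w hw => (hsumm w hw).of_norm.hasSum
  obtain ⟨x, hx⟩ := exists_forall_tendsto_of_approx F s (by
    intro ε hε
    -- Each of the three errors gets ε / 3; `k` is fixed before `m`, because the tail concerns `M
    -- k`.
    obtain ⟨k, hk⟩ : ∃ k : ℕ, μ.real univ * (1 / (k + 1 : ℝ)) ≤ ε / 3 := by
      have := (tendsto_one_div_add_atTop_nhds_zero_nat (𝕜 := ℝ)).const_mul (μ.real univ)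
      rw [mul_zero] at this
      exact (this.eventually (ge_mem_nhds (by positivity))).exists
    obtain ⟨m, hm⟩ := ((tendsto_lintegral_tail hN (hM k) hNi).eventually
      (ge_mem_nhds (ENNReal.ofReal_pos.2 (show 0 < ε / 3 by positivity)))).exists
    refine ⟨(μ.real univ * m) • L, isCompact_toWeakSpace_smul hL _, ?_⟩
    rw [convexHull_smul]
    have hev : ∀ᶠ w in (F : Filter (Ω → ℝ≥0)), ∃ a ∈ (μ.real univ * m) • convexHull ℝ L,
        ‖s w - a‖ ≤ ε := by
      filter_upwards [hF 0 N hN, hF (k + 1) _ (measurable_natPair hN (hM k))] with w hw hw'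
      obtain ⟨a, ha, hle⟩ := exists_norm_tsum_sub_le (convex_convexHull ℝ L) h0 (hfN' (k + 1))
        (by positivity) (show 0 < ε / 3 by positivity) (hEM k) hm (fun _ => rfl) hw' (hs w hw)
      exact ⟨a, ha, by linarith⟩
    classical
    refine ⟨fun w => if h : ∃ a ∈ (μ.real univ * m) • convexHull ℝ L, ‖s w - a‖ ≤ ε then h.choose
      else 0, ?_⟩
    filter_upwards [hev] with w hw
    rw [dif_pos hw]
    exact hw.choose_spec)
  refine ⟨x, fun ε hε P => ?_⟩
  obtain ⟨p, hp, hpP⟩ := P.exists_index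
  -- `π₀` makes the cells good, `N` gives absolute convergence, and `p` refines the given partition.
  let π : Ω → ℕ := fun t => Nat.pair (π₀ t) (Nat.pair (N t) (p t))
  have hπ : Measurable π := measurable_natPair hπ₀ (measurable_natPair hN hp)
  have hπN : sampleWeights μ (E 0) π ⊆ sampleWeights μ (E 0) N :=
    sampleWeights_mono subset_rfl (fun q => q.unpair.2.unpair.1) fun t => by simp [π]
  -- Mazur's theorem: the weak limit lies in the norm closure of the convex set of sums, so some sum
  -- for this very `π` is within `ε`.
  have hxc := mem_of_forall_tendsto (convex_sampleSums μ (E 0) π f).closure isClosed_closure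
    (F := (F : Filter (Ω → ℝ≥0))) (a := s) (by
      filter_upwards [hF 0 π hπ] with w hw
      exact subset_closure ⟨w, hw, hs w (hπN hw)⟩) hx
  obtain ⟨y, ⟨w, hw, hy⟩, hxy⟩ := Metric.mem_closure_iff.1 hxc ε hε
  have hEE : E 0 ⊆ E₀ := (hEsub 0).trans sdiff_subset
  obtain ⟨Γ, hΓ, T, hT, hTa, hTs⟩ := exists_sampling_of_mem_sampleWeights (P := P)
    (hsep.mono hEE) hπ
    (fun n => (hgood n.unpair.1).mono hEE fun t ht => by
      have : π t = n := ht
      simp [← this, π])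
    (fun t t' h => hpP t t' (by
      have := congrArg (fun q : ℕ => q.unpair.2.unpair.2) h
      simpa [π] using this)) hw (hsumm w (hπN hw)) hy
  refine ⟨Γ, hΓ, T, hT, hTa, ?_⟩
  rw [hTs, ← dist_eq_norm, dist_comm]
  exact hxy

end LimitSet

end RLIntegral

end

theorem mainTheorem4 {Ω : Type*} [MeasurableSpace Ω] (μ : Measure Ω) [IsFiniteMeasure μ]
    (hμ : RLIntegral.AtomsChargePoints μ)
    {X : Type*} [NormedAddCommGroup X] [NormedSpace ℝ X] [CompleteSpace X]
    (hX : RLIntegral.IsWCG X) (f : Ω → X) (hf : f ∈ RLIntegral.upperL1 μ X) :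
    (RLIntegral.limitSet μ f).Nonempty :=
  RLIntegral.limitSet_nonempty hμ hX hf
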